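/- \textbf{Corollary (Low influence functions are local).} Let $\Omega_1,\dots,\Omega_d$ be finite sets and let $X$ be a $d$-partite complex, i.e. a probability distribution $\Pi$ on $\Omega_1\times\cdots\times\Omega_d$; write $x\in X$ if $\Pi(x)>0$. Expectations are with respect to $x\sim\Pi$ unless stated otherwise. For $S\subseteq[d]$ let $X[S]=\{x_S : x\in X\}$ be the set of projections of points of $X$ to the coordinates in $S$. For $z\in X[S]$ let the link $X_z$ be the distribution of $x\sim\Pi$ conditioned on $x_S=z$, and let $\mathbb{E}[f|_{z}]=\mathbb{E}[f(x)\mid x_S=z]$. The complex $X$ is a \emph{$\gamma$-product} if for all $S\subseteq[d]$, $z\in X[S]$ and distinct $i,j\notin S$, the bipartite walk operator $A^z_{i,j}g(b)=\mathbb{E}[g(x_i)\mid x_j=b,\ x_S=z]$ satisfies $\lambda_2(A^z_{i,j})\le\gamma$, that is, $\|A^z_{i,j}g-\mathbb{E}_{X_z}[g]\|_2\le\gamma\|g\|_2$ for every $g:\Omega_i\to\mathbb{R}$, where $\mathbb{E}_{X_z}[g]=\mathbb{E}[g(x_i)\mid x_S=z]$ and the $2$-norms are taken over the marginals of $X_z$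 on the coordinates $j$ and $i$ respectively. For real-valued $f$ on $X$ let $\mathrm{Var}(f)=\mathbb{E}[(f-\mathbb{E}f)^2]$ and let the total influence be $\mathbf{I}[f]=\sum_{i=1}^d\mathbb{E}[f\cdot L_if]$, where $L_if(y)=f(y)-\mathbb{E}[f(x)\mid x_j=y_j\ \forall j\ne i]$. Functions $f:X\to\mathbb{F}_2$ are regarded as real functions with values in $\{0,1\}$. There are absolute constants $c,C>0$ such that the following holds for every $d$. Let $X$ be a $d$-partite $\gamma$-product with $\gamma\le 2^{-cd}$, let $K\ge 0$ be real, and let $f:X\to\mathbb{F}_2$ be a function that is not identically zero and satisfies $\mathbf{I}[f]\le K\cdot\mathrm{Var}(f)$. Then there exist $S\subseteq[d]$ with $|S|\le CK$ and $x_S\in X[S]$ such that \[ \mathbb{E}[f|_{x_S}]\ \ge\ 2^{-CK}. \] -/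

import Mathlib

/-- A (finite, weighted) `d`-partite complex with colour classes `Ω 0, …, Ω (d-1)`, viewed as a
probability distribution on `∏ i, Ω i`. Its top-level faces are the tuples of positive weight. -/
structure PartiteComplex {d : ℕ} (Ω : Fin d → Type*) [∀ i, Fintype (Ω i)] where
  weight : (∀ i, Ω i) → ℝ
  weight_nonneg : ∀ x, 0 ≤ weight x
  sum_weight : ∑ x, weight x = 1

namespace PartiteComplex

variable {d : ℕ} {Ω : Fin d → Type*} [∀ i, Fintype (Ω i)]

/-- The top-level faces, i.e. the support of the distribution. -/
def faces (X : PartiteComplex Ω) : Set (∀ i, Ω i) := {x | 0 < X.weight x}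

/-- `𝔼[g]`. Only the values of `g` on `X.faces` matter. -/
noncomputable def expect (X : PartiteComplex Ω) (g : (∀ i, Ω i) → ℝ) : ℝ :=
  ∑ x, X.weight x * g x

/-- The probability of an event. -/
noncomputable def prob (X : PartiteComplex Ω) (A : Set (∀ i, Ω i)) : ℝ :=
  X.expect (A.indicator 1)

/-- The conditional expectation `𝔼[g | A]` given an event `A` of positive probability. -/
noncomputable def condExpect (X : PartiteComplex Ω) (A : Set (∀ i, Ω i))
    (g : (∀ i, Ω i) → ℝ) : ℝ :=
  X.expect (A.indicator g) / X.prob A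

/-- `‖g‖₂`. -/
noncomputable def l2norm (X : PartiteComplex Ω) (g : (∀ i, Ω i) → ℝ) : ℝ :=
  Real.sqrt (X.expect (fun x => g x ^ 2))

/-- `Var(g) = 𝔼[(g - 𝔼[g])²]`. -/
noncomputable def variance (X : PartiteComplex Ω) (g : (∀ i, Ω i) → ℝ) : ℝ :=
  X.expect (fun x => (g x - X.expect g) ^ 2)

/-- The event `x_S = z`. -/
def cylinder (S : Finset (Fin d)) (z : ∀ i : S, Ω i) : Set (∀ i, Ω i) := {x | S.restrict x = z}

/-- `X[S]`: the projections of the faces to the coordinates in `S`. -/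
def projFaces (X : PartiteComplex Ω) (S : Finset (Fin d)) : Set (∀ i : S, Ω i) :=
  S.restrict '' X.faces

theorem prob_cylinder_pos (X : PartiteComplex Ω) {S : Finset (Fin d)} {z : ∀ i : S, Ω i}
    (hz : z ∈ X.projFaces S) : 0 < X.prob (cylinder S z) := by
  classical
  obtain ⟨x, hx, rfl⟩ := hz
  have hx' : 0 < X.weight x := hx
  refine Finset.sum_pos' (fun y _ => mul_nonneg (X.weight_nonneg y) ?_) ⟨x, Finset.mem_univ x, ?_⟩
  · exact Set.indicator_nonneg (fun _ _ => zero_le_one) _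
  · have hmem : x ∈ cylinder S (S.restrict x) := rfl
    simpa [Set.indicator_of_mem hmem] using hx'

/-- The link `X_z` of `z ∈ X[S]`: the distribution of `x` conditioned on `x_S = z`. It is kept as a
distribution on all coordinates; those in `S` are constantly equal to `z`. -/
noncomputable def link (X : PartiteComplex Ω) (S : Finset (Fin d)) (z : ∀ i : S, Ω i)
    (hz : z ∈ X.projFaces S) : PartiteComplex Ω where
  weight x := (cylinder S z).indicator X.weight x / X.prob (cylinder S z)
  weight_nonneg x := div_nonneg
    (Set.indicator_nonneg (fun y _ => X.weight_nonneg y) x) (X.prob_cylinder_pos hz).le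
  sum_weight := by
    classical
    rw [← Finset.sum_div, div_eq_one_iff_eq (X.prob_cylinder_pos hz).ne']
    refine Finset.sum_congr rfl fun x _ => ?_
    by_cases h : x ∈ cylinder S z <;> simp [h]

/-- The bipartite walk `A_{i,j}`: `(A_{i,j} g)(b) = 𝔼[g(x_i) | x_j = b]`. -/
noncomputable def walk (X : PartiteComplex Ω) (i j : Fin d) (g : Ω i → ℝ) (b : Ω j) : ℝ :=
  X.condExpect {x | x j = b} (fun x => g (x i))

/-- `λ₂(A_{i,j}) ≤ γ`, that is `‖A_{i,j} - Π_{i,j}‖₂ ≤ γ` as an operator norm from functions of `x_i`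
to functions of `x_j`, where `Π_{i,j} g` is the constant `𝔼[g(x_i)]`. -/
def WalkExpands (X : PartiteComplex Ω) (i j : Fin d) (γ : ℝ) : Prop :=
  ∀ g : Ω i → ℝ,
    X.l2norm (fun x => X.walk i j g (x j) - X.expect (fun y => g (y i))) ≤
      γ * X.l2norm (fun x => g (x i))

/-- `X` is a `γ`-product: `λ₂(A_{i,j}) ≤ γ` for all colours `i ≠ j` in every link that fixes
neither of them. -/
def IsGammaProduct (X : PartiteComplex Ω) (γ : ℝ) : Prop :=
  ∀ (S : Finset (Fin d)) (z : ∀ i : S, Ω i) (hz : z ∈ X.projFaces S) (i j : Fin d),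
    i ∉ S → j ∉ S → i ≠ j → (X.link S z hz).WalkExpands i j γ

/-- The projection `(E_T g)(y) = 𝔼[g(x) | x_T = y_T]`. -/
noncomputable def proj (X : PartiteComplex Ω) (T : Finset (Fin d)) (g : (∀ i, Ω i) → ℝ)
    (y : ∀ i, Ω i) : ℝ :=
  X.condExpect (cylinder T (T.restrict y)) g

/-- The Laplacian `L_i = I - E_{[d] \ {i}}`. -/
noncomputable def laplacian (X : PartiteComplex Ω) (i : Fin d) (g : (∀ i, Ω i) → ℝ)
    (y : ∀ i, Ω i) : ℝ :=
  g y - X.proj (Finset.univ.erase i) g y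

/-- The total influence `I[g] = ∑ i, ⟨g, L_i g⟩`. -/
noncomputable def totalInfluence (X : PartiteComplex Ω) (g : (∀ i, Ω i) → ℝ) : ℝ :=
  ∑ i, X.expect (fun x => g x * X.laplacian i g x)

end PartiteComplex

/-- An `𝔽₂`-valued function, read as a real function with values in `{0, 1}`. -/
def toReal01 {α : Type*} (f : α → ZMod 2) (x : α) : ℝ := ((f x).val : ℝ)

/-! Write `E_S` for conditional expectation on `x_S`. In a `γ`-product with tiny `γ`, `E_S E_T` is
close to `E_{S∩T}` in operator norm, as it would be exactly in a product space. Hence the components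
`f_S = ∑_{T ⊆ S} (-1)^{|S \ T|} E_T f` form an approximate Efron–Stein decomposition: they always
sum to `f`, they are nearly orthogonal, and `∑ |S| 𝔼[f f_S]` is nearly bounded by the total
influence. Since `γ` is exponentially small in `d`, it absorbs factors exponential in `d` from sums
over subsets. The mean `μ` of `f` may be arbitrarily small, so every error must also carry a factor
`‖f‖² = μ`.

Let `f` be Boolean, `r` about `4K`, and `g` the part of `f` of degree at most `r`. Low influence
bounds the tail by `μ/4`, so `𝔼[f g] ≥ 3μ/4`. Since `f = f²`, Cauchy–Schwarz gives `𝔼[f g]² ≤ μ 𝔼[f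
g²]`. It thus suffices to contradict this by showing `𝔼[f g²] ≤ μ/16` when all densities `𝔼[f |
x_V]` with `|V| ≤ 2r` are at most `δ = 2^(-26r)`.

Expand `𝔼[f g²]` into the terms `𝔼[f_U f_S f_T]`. A term with a coordinate in exactly one of the
three sets is negligible. Otherwise conditional Cauchy–Schwarz bounds it by the average of the
product of `√(E_W f_Q²)` over `Q = U, S, T`, with `W = U ∩ S ∩ T`. For fixed `W` such a triple is a
triangle on the three pairwise parts, and the triangle inequality of `sum_triangle_le` bounds the
sum by the `3/2` power of `linkEnergy`. Globalness makes the link energy `O_r(δ)` up to errors,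
because a component containing `W` is a signed sum of components of `f` in links of `x_V`, `V ⊆ W`.
As the link energies sum to `O_r(μ)`, the spare half power gains about `√δ`
(`AlmostCommute.sum_avg_sqrt_linkEnergy_le`). -/

namespace PartiteComplex

variable {d : ℕ} {Ω : Fin d → Type*} [∀ i, Fintype (Ω i)] (X : PartiteComplex Ω)

/-! ### Averages, conditional expectations and `L²` norms on the faces -/

noncomputable instance instFintypeFaces : Fintype X.faces := Fintype.ofFinite _

/-- Two faces agree on the coordinates in `S`. -/
def Agree (S : Finset (Fin d)) (x y : X.faces) : Prop := ∀ i ∈ S, x.1 i = y.1 i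

/-- A function of the coordinates in `S`. -/
def IsJunta (S : Finset (Fin d)) (g : X.faces → ℝ) : Prop :=
  ∀ x y, X.Agree S x y → g x = g y

/-- The probability of a face. -/
def wt (x : X.faces) : ℝ := X.weight x.1

open Classical in
/-- The weight of the faces that agree with `y` on `S`. -/
noncomputable def mass (S : Finset (Fin d)) (y : X.faces) : ℝ :=
  ∑ x, if X.Agree S x y then X.wt x else 0

/-- The expectation of a function on the faces. -/
noncomputable def avg : (X.faces → ℝ) →ₗ[ℝ] ℝ where
  toFun g := ∑ x, X.wt x * g x
  map_add' g h := by simp [mul_add, Finset.sum_add_distrib]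
  map_smul' c g := by simp [Finset.mul_sum, mul_left_comm]

open Classical in
/-- The conditional expectation of a function on the faces, given the coordinates in `S`. -/
noncomputable def cexp (S : Finset (Fin d)) : (X.faces → ℝ) →ₗ[ℝ] (X.faces → ℝ) where
  toFun g y := (∑ x, if X.Agree S x y then X.wt x * g x else 0) / X.mass S y
  map_add' g h := by
    ext y
    simp only [Pi.add_apply, ← add_div, ← Finset.sum_add_distrib]
    congr 1
    refine Finset.sum_congr rfl fun x _ => ?_
    split_ifs <;> ring
  map_smul' c g := by
    ext y
    simp only [Pi.smul_apply, smul_eq_mul, RingHom.id_apply, ← mul_div_assoc, Finset.mul_sum]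
    congr 1
    refine Finset.sum_congr rfl fun x _ => ?_
    split_ifs <;> ring

open Classical in
theorem cexp_apply (S : Finset (Fin d)) (g : X.faces → ℝ) (y : X.faces) :
    X.cexp S g y = (∑ x, if X.Agree S x y then X.wt x * g x else 0) / X.mass S y := rfl

theorem avg_apply (g : X.faces → ℝ) : X.avg g = ∑ x, X.wt x * g x := rfl

variable {X} {S T : Finset (Fin d)} {g h : X.faces → ℝ}

theorem wt_pos (x : X.faces) : 0 < X.wt x := x.2

theorem Agree.refl (S : Finset (Fin d)) (x : X.faces) : X.Agree S x x := fun _ _ => rfl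

theorem Agree.symm {x y : X.faces} (hxy : X.Agree S x y) : X.Agree S y x :=
  fun i hi => (hxy i hi).symm

theorem Agree.trans {x y z : X.faces} (hxy : X.Agree S x y) (hyz : X.Agree S y z) :
    X.Agree S x z := fun i hi => (hxy i hi).trans (hyz i hi)

theorem Agree.mono (hST : S ⊆ T) {x y : X.faces} (hxy : X.Agree T x y) : X.Agree S x y :=
  fun i hi => hxy i (hST hi)

theorem agree_comm {x y : X.faces} : X.Agree S x y ↔ X.Agree S y x := ⟨Agree.symm, Agree.symm⟩

theorem agree_congr_right {x y z : X.faces} (hyz : X.Agree S y z) :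
    X.Agree S x y ↔ X.Agree S x z :=
  ⟨fun h => h.trans hyz, fun h => h.trans hyz.symm⟩

theorem IsJunta.mono (hST : S ⊆ T) (hg : X.IsJunta S g) : X.IsJunta T g :=
  fun x y hxy => hg x y (hxy.mono hST)

theorem IsJunta.mul (hg : X.IsJunta S g) (hh : X.IsJunta S h) : X.IsJunta S (g * h) :=
  fun x y hxy => by simp [hg x y hxy, hh x y hxy]

theorem IsJunta.sub (hg : X.IsJunta S g) (hh : X.IsJunta S h) : X.IsJunta S (g - h) :=
  fun x y hxy => by simp [hg x y hxy, hh x y hxy]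

/-- Positivity is the gain from working on the faces instead of all tuples: every conditioning event
has positive weight, so identities for `cexp` hold at every point. -/
theorem mass_pos (S : Finset (Fin d)) (y : X.faces) : 0 < X.mass S y := by
  classical
  refine Finset.sum_pos' (fun x _ => ?_) ⟨y, Finset.mem_univ y, ?_⟩
  · split_ifs
    exacts [(wt_pos x).le, le_rfl]
  · simpa [Agree.refl] using wt_pos y

theorem mass_congr {x y : X.faces} (hxy : X.Agree S x y) : X.mass S x = X.mass S y := by
  classical
  refine Finset.sum_congr rfl fun z _ => ?_
  simp only [agree_congr_right hxy]

theorem isJunta_cexp (S : Finset (Fin d)) (g : X.faces → ℝ) : X.IsJunta S (X.cexp S g) := by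
  classical
  intro x y hxy
  simp only [cexp_apply, agree_congr_right hxy, mass_congr hxy]

theorem cexp_mul_of_isJunta (hh : X.IsJunta S h) (g : X.faces → ℝ) :
    X.cexp S (h * g) = h * X.cexp S g := by
  classical
  ext y
  simp only [cexp_apply, Pi.mul_apply, ← mul_div_assoc, Finset.mul_sum]
  congr 1
  refine Finset.sum_congr rfl fun x _ => ?_
  split_ifs with hxy
  · rw [hh x y hxy]; ring
  · ring

theorem cexp_one (S : Finset (Fin d)) : X.cexp S 1 = 1 := by
  classical
  ext y
  simp only [cexp_apply, Pi.one_apply, mul_one]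
  exact div_self (mass_pos S y).ne'

theorem cexp_of_isJunta (hh : X.IsJunta S h) : X.cexp S h = h := by
  simpa [cexp_one] using cexp_mul_of_isJunta hh 1

theorem avg_cexp (S : Finset (Fin d)) (g : X.faces → ℝ) : X.avg (X.cexp S g) = X.avg g := by
  classical
  simp only [avg_apply, cexp_apply, Finset.sum_div, Finset.mul_sum]
  rw [Finset.sum_comm]
  refine Finset.sum_congr rfl fun x _ => ?_
  have h1 : ∀ y, X.wt y * ((if X.Agree S x y then X.wt x * g x else 0) / X.mass S y) =
      (if X.Agree S y x then X.wt y else 0) * (X.wt x * g x / X.mass S x) := by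
    intro y
    rw [agree_comm (x := y)]
    split_ifs with hxy
    · rw [mass_congr hxy]
    · simp
  simp only [h1, ← Finset.sum_mul]
  change X.mass S x * _ = _
  field_simp [(mass_pos S x).ne']

open Classical in
theorem cexp_eq_avg_div (S : Finset (Fin d)) (g : X.faces → ℝ) (y : X.faces) :
    X.cexp S g y = X.avg ((fun x => if X.Agree S x y then (1 : ℝ) else 0) * g) / X.mass S y := by
  rw [cexp_apply, avg_apply]
  congr 1
  refine Finset.sum_congr rfl fun x _ => ?_
  by_cases hxy : X.Agree S x y <;> simp [hxy]

theorem cexp_cexp_of_subset (hST : S ⊆ T) (g : X.faces → ℝ) :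
    X.cexp S (X.cexp T g) = X.cexp S g := by
  classical
  ext y
  rw [cexp_eq_avg_div, cexp_eq_avg_div, ← cexp_mul_of_isJunta, avg_cexp]
  intro x z hxz
  have : X.Agree S x y ↔ X.Agree S z y := by
    rw [agree_comm, agree_congr_right (hxz.mono hST), agree_comm]
  simp [this]

theorem cexp_cexp_of_superset (hST : S ⊆ T) (g : X.faces → ℝ) :
    X.cexp T (X.cexp S g) = X.cexp S g :=
  cexp_of_isJunta ((isJunta_cexp S g).mono hST)

theorem expect_eq_avg (g : (∀ i, Ω i) → ℝ) : X.expect g = X.avg (fun x => g x.1) := by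
  classical
  rw [expect, ← Finset.sum_subset (Finset.subset_univ (Finset.univ.filter (· ∈ X.faces)))]
  · exact Finset.sum_subtype _ (by simp) _
  · intro x _ hx
    have hx' : ¬ 0 < X.weight x := fun h =>
      hx (Finset.mem_filter.2 ⟨Finset.mem_univ x, h⟩)
    rw [le_antisymm (not_lt.1 hx') (X.weight_nonneg x), zero_mul]

theorem avg_one : X.avg 1 = 1 := by
  have := expect_eq_avg (X := X) 1
  simp only [expect, Pi.one_apply, mul_one, X.sum_weight] at this
  exact this.symm

theorem cexp_empty (g : X.faces → ℝ) : X.cexp ∅ g = fun _ => X.avg g := by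
  classical
  have h1 : ∀ x y : X.faces, X.Agree ∅ x y := fun x y i hi => by simp at hi
  ext y
  have h2 : X.mass ∅ y = 1 := by
    rw [← avg_one (X := X), avg_apply]
    simp [mass, h1]
  simp [cexp_apply, h1, h2, avg_apply]

theorem isJunta_univ (g : X.faces → ℝ) : X.IsJunta Finset.univ g := by
  intro x y hxy
  have : x = y := Subtype.ext (funext fun i => hxy i (Finset.mem_univ i))
  rw [this]

theorem cexp_univ (g : X.faces → ℝ) : X.cexp Finset.univ g = g := cexp_of_isJunta (isJunta_univ g)

theorem cexp_mono (hgh : g ≤ h) : X.cexp S g ≤ X.cexp S h := by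
  classical
  intro y
  rw [cexp_apply, cexp_apply]
  refine div_le_div_of_nonneg_right (Finset.sum_le_sum fun x _ => ?_) (mass_pos S y).le
  split_ifs
  · exact mul_le_mul_of_nonneg_left (hgh x) (wt_pos x).le
  · exact le_rfl

theorem cexp_nonneg (hg : 0 ≤ g) : 0 ≤ X.cexp S g := by
  simpa using cexp_mono (S := S) hg

theorem avg_mono (hgh : g ≤ h) : X.avg g ≤ X.avg h :=
  Finset.sum_le_sum fun x _ => mul_le_mul_of_nonneg_left (hgh x) (wt_pos x).le

theorem avg_nonneg (hg : 0 ≤ g) : 0 ≤ X.avg g := by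
  simpa using avg_mono hg

theorem cexp_const (S : Finset (Fin d)) (c : ℝ) : X.cexp S (fun _ => c) = fun _ => c :=
  cexp_of_isJunta fun _ _ _ => rfl

theorem avg_const (c : ℝ) : X.avg (fun _ => c) = c := by
  have h1 : (fun _ => c : X.faces → ℝ) = c • 1 := by ext; simp
  rw [h1, map_smul, avg_one, smul_eq_mul, mul_one]

theorem abs_cexp_le (S : Finset (Fin d)) (g : X.faces → ℝ) : |X.cexp S g| ≤ X.cexp S |g| := by
  refine abs_le'.2 ⟨cexp_mono (le_abs_self g), ?_⟩
  rw [← map_neg]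
  exact cexp_mono (neg_le_abs g)

theorem abs_avg_le (g : X.faces → ℝ) : |X.avg g| ≤ X.avg |g| := by
  refine abs_le'.2 ⟨avg_mono (le_abs_self g), ?_⟩
  rw [← map_neg]
  exact avg_mono (neg_le_abs g)

theorem avg_abs_cexp_le (S : Finset (Fin d)) (g : X.faces → ℝ) :
    X.avg |X.cexp S g| ≤ X.avg |g| :=
  (avg_mono (abs_cexp_le S g)).trans_eq (avg_cexp S _)

theorem abs_cexp_le_of_bound {M : ℝ} (hg : ∀ x, |g x| ≤ M) (y : X.faces) : |X.cexp S g y| ≤ M := by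
  refine (abs_cexp_le S g y).trans ?_
  refine (cexp_mono (S := S) (g := |g|) (h := fun _ => M) hg y).trans_eq ?_
  rw [cexp_const]

theorem avg_mul_sq_le (g h : X.faces → ℝ) :
    X.avg (g * h) ^ 2 ≤ X.avg (g * g) * X.avg (h * h) := by
  have key := Finset.sum_mul_sq_le_sq_mul_sq Finset.univ (fun x => √(X.wt x) * g x)
    (fun x => √(X.wt x) * h x)
  have h1 : ∀ x, √(X.wt x) * √(X.wt x) = X.wt x := fun x => Real.mul_self_sqrt (wt_pos x).le
  have h2 : ∀ a b : X.faces → ℝ,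
      ∑ x, (√(X.wt x) * a x) * (√(X.wt x) * b x) = X.avg (a * b) := by
    intro a b
    refine Finset.sum_congr rfl fun x _ => ?_
    rw [Pi.mul_apply, mul_mul_mul_comm, h1]
  simp only [pow_two (√ _ * _), h2] at key
  exact key

/-- The indicator of the fibre is idempotent, so it can be distributed over both factors and the
unconditional Cauchy–Schwarz inequality applies. -/
theorem cexp_mul_sq_le (S : Finset (Fin d)) (g h : X.faces → ℝ) (y : X.faces) :
    X.cexp S (g * h) y ^ 2 ≤ X.cexp S (g * g) y * X.cexp S (h * h) y := by
  classical
  set e : X.faces → ℝ := fun x => if X.Agree S x y then (1 : ℝ) else 0 with he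
  have hee : e * e = e := by
    ext x
    by_cases hx : X.Agree S x y <;> simp [he, hx]
  have h1 : ∀ a b : X.faces → ℝ, e * (a * b) = (e * a) * (e * b) := by
    intro a b
    rw [mul_mul_mul_comm, hee]
  rw [cexp_eq_avg_div, cexp_eq_avg_div, cexp_eq_avg_div, div_pow, div_mul_div_comm,
    ← pow_two (X.mass S y), ← he, h1, h1, h1]
  exact div_le_div_of_nonneg_right (avg_mul_sq_le _ _) (sq_nonneg _)

variable (X) in
/-- The `L²`-norm of a function on the faces. -/
noncomputable def nrm (g : X.faces → ℝ) : ℝ := √(X.avg (g * g))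

theorem avg_mul_self_nonneg (g : X.faces → ℝ) : 0 ≤ X.avg (g * g) :=
  avg_nonneg fun x => mul_self_nonneg (g x)

theorem nrm_nonneg (g : X.faces → ℝ) : 0 ≤ X.nrm g := Real.sqrt_nonneg _

theorem nrm_sq (g : X.faces → ℝ) : X.nrm g ^ 2 = X.avg (g * g) :=
  Real.sq_sqrt (avg_mul_self_nonneg g)

theorem abs_avg_mul_le (g h : X.faces → ℝ) : |X.avg (g * h)| ≤ X.nrm g * X.nrm h := by
  refine abs_le_of_sq_le_sq ?_ (mul_nonneg (nrm_nonneg g) (nrm_nonneg h))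
  rw [mul_pow, nrm_sq, nrm_sq]
  exact avg_mul_sq_le g h

theorem nrm_abs (g : X.faces → ℝ) : X.nrm |g| = X.nrm g := by
  have h1 : |g| * |g| = g * g := funext fun x => abs_mul_abs_self (g x)
  rw [nrm, h1, nrm]

theorem avg_abs_mul_le (g h : X.faces → ℝ) : X.avg |g * h| ≤ X.nrm g * X.nrm h := by
  have h1 : |g * h| = |g| * |h| := funext fun x => abs_mul (g x) (h x)
  have h2 := (le_abs_self _).trans (abs_avg_mul_le |g| |h|)
  rwa [nrm_abs, nrm_abs, ← h1] at h2

theorem nrm_add_le (g h : X.faces → ℝ) : X.nrm (g + h) ≤ X.nrm g + X.nrm h := by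
  refine abs_le_of_sq_le_sq' ?_ (add_nonneg (nrm_nonneg g) (nrm_nonneg h)) |>.2
  have h1 : (g + h) * (g + h) = g * g + (2 : ℝ) • (g * h) + h * h := by
    ext x; simp; ring
  have h2 := (le_abs_self _).trans (abs_avg_mul_le g h)
  rw [nrm_sq, h1, map_add, map_add, map_smul, ← nrm_sq, ← nrm_sq, smul_eq_mul]
  nlinarith

theorem nrm_zero : X.nrm 0 = 0 := by simp [nrm]

theorem nrm_neg (g : X.faces → ℝ) : X.nrm (-g) = X.nrm g := by simp [nrm]

theorem nrm_sub_le (g h : X.faces → ℝ) : X.nrm (g - h) ≤ X.nrm g + X.nrm h := by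
  rw [sub_eq_add_neg, ← nrm_neg h]
  exact nrm_add_le _ _

theorem nrm_sum_le {ι : Type*} (s : Finset ι) (F : ι → X.faces → ℝ) :
    X.nrm (∑ i ∈ s, F i) ≤ ∑ i ∈ s, X.nrm (F i) := by
  classical
  induction s using Finset.induction_on with
  | empty => simp [nrm_zero]
  | insert i s hi ih =>
    rw [Finset.sum_insert hi, Finset.sum_insert hi]
    exact (nrm_add_le _ _).trans (by gcongr)

theorem nrm_le_of_sq_le {a : ℝ} (ha : 0 ≤ a) (hg : X.avg (g * g) ≤ a ^ 2) : X.nrm g ≤ a :=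
  Real.sqrt_le_iff.2 ⟨ha, hg⟩

theorem nrm_cexp_le (S : Finset (Fin d)) (g : X.faces → ℝ) : X.nrm (X.cexp S g) ≤ X.nrm g := by
  refine Real.sqrt_le_sqrt ?_
  rw [← avg_cexp S (g * g)]
  refine avg_mono fun y => ?_
  have h1 := cexp_mul_sq_le S 1 g y
  simp only [one_mul, cexp_one, Pi.one_apply] at h1
  simpa [pow_two] using h1

theorem nrm_mul_le {M : ℝ} (hg : ∀ x, |g x| ≤ M) (h : X.faces → ℝ) :
    X.nrm (g * h) ≤ M * X.nrm h := by
  rcases isEmpty_or_nonempty X.faces with hX | ⟨⟨x0⟩⟩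
  · have h1 : ∀ k : X.faces → ℝ, X.nrm k = 0 := fun k => by simp [nrm, avg_apply]
    simp [h1]
  have hM : 0 ≤ M := (abs_nonneg _).trans (hg x0)
  refine nrm_le_of_sq_le (mul_nonneg hM (nrm_nonneg h)) ?_
  rw [mul_pow, nrm_sq, ← smul_eq_mul (M ^ 2), ← map_smul]
  refine avg_mono fun x => ?_
  have h1 : g x ^ 2 ≤ M ^ 2 := sq_le_sq' (abs_le.1 (hg x)).1 (abs_le.1 (hg x)).2
  have h2 := mul_le_mul_of_nonneg_right h1 (sq_nonneg (h x))
  simp only [Pi.mul_apply, Pi.smul_apply, smul_eq_mul]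
  nlinarith

theorem nrm_smul (c : ℝ) (g : X.faces → ℝ) : X.nrm (c • g) = |c| * X.nrm g := by
  have : c • g * c • g = (c ^ 2) • (g * g) := by ext x; simp; ring
  rw [nrm, this, map_smul, smul_eq_mul, Real.sqrt_mul (sq_nonneg c), Real.sqrt_sq_eq_abs, nrm]

end PartiteComplex

/-! ### From walks in links to almost commuting conditional expectations -/

namespace PartiteComplex

variable {d : ℕ} {Ω : Fin d → Type*} [∀ i, Fintype (Ω i)] {X : PartiteComplex Ω}
  {S T : Finset (Fin d)} {g h : X.faces → ℝ}

theorem agree_iff_mem_cylinder {x y : X.faces} :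
    X.Agree S x y ↔ x.1 ∈ cylinder S (S.restrict y.1) := by
  constructor
  · intro h
    exact funext fun i => h i.1 i.2
  · intro h i hi
    exact congrFun h ⟨i, hi⟩

theorem mass_eq_prob (S : Finset (Fin d)) (y : X.faces) :
    X.mass S y = X.prob (cylinder S (S.restrict y.1)) := by
  classical
  rw [prob, expect_eq_avg]
  refine Finset.sum_congr rfl fun x _ => ?_
  by_cases hx : x.1 ∈ cylinder S (S.restrict y.1) <;>
    simp [agree_iff_mem_cylinder, hx]

theorem condExpect_cylinder (g : (∀ i, Ω i) → ℝ) (y : X.faces) :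
    X.condExpect (cylinder S (S.restrict y.1)) g = X.cexp S (fun x => g x.1) y := by
  classical
  rw [condExpect, cexp_apply, expect_eq_avg, ← mass_eq_prob]
  congr 1
  refine Finset.sum_congr rfl fun x _ => ?_
  by_cases hx : x.1 ∈ cylinder S (S.restrict y.1) <;>
    simp [agree_iff_mem_cylinder, hx]

theorem link_expect (y : X.faces) (hz : S.restrict y.1 ∈ X.projFaces S) (g : (∀ i, Ω i) → ℝ) :
    (X.link S (S.restrict y.1) hz).expect g = X.cexp S (fun x => g x.1) y := by
  classical
  rw [← condExpect_cylinder, condExpect, expect, expect, Finset.sum_div]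
  refine Finset.sum_congr rfl fun x _ => ?_
  by_cases hx : x ∈ cylinder S (S.restrict y.1) <;> simp [link, hx]
  ring

theorem agree_insert {j : Fin d} {x y : X.faces} :
    X.Agree (insert j S) x y ↔ x.1 j = y.1 j ∧ X.Agree S x y := by
  simp [Agree]

theorem link_walk {i j : Fin d} (y y' : X.faces) (hy : X.Agree S y' y)
    (hz : S.restrict y.1 ∈ X.projFaces S) (g : Ω i → ℝ) :
    (X.link S (S.restrict y.1) hz).walk i j g (y'.1 j) =
      X.cexp (insert j S) (fun x => g (x.1 i)) y' := by
  classical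
  have h1 : ∀ x : X.faces, X.Agree (insert j S) x y' ↔ x.1 j = y'.1 j ∧ X.Agree S x y :=
    fun x => by rw [agree_insert, agree_congr_right hy]
  rw [walk, condExpect, prob, link_expect, link_expect, cexp_apply, cexp_apply, cexp_apply,
    div_div_div_cancel_right₀ (mass_pos S y).ne', mass]
  congr 1 <;>
  · refine Finset.sum_congr rfl fun x _ => ?_
    rw [h1]
    by_cases hx : X.Agree S x y <;> by_cases hx' : x.1 j = y'.1 j <;> simp [hx, hx']

/-- Inside the link of `x_S`, the function `cexp (insert i S) g` depends on `x_i` alone, so it can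
serve as the test function of the walk; the walk then acts as conditioning on `x_j`. -/
theorem WalkExpands.cexp_sq_le {γ : ℝ} (hγ : 0 ≤ γ) {i j : Fin d} (y : X.faces)
    (hz : S.restrict y.1 ∈ X.projFaces S)
    (hX : (X.link S (S.restrict y.1) hz).WalkExpands i j γ) (g : X.faces → ℝ) :
    X.cexp S ((X.cexp (insert j S) (X.cexp (insert i S) g) - X.cexp S g) ^ 2) y ≤
      γ ^ 2 * X.cexp S (X.cexp (insert i S) g ^ 2) y := by
  classical
  -- Values `a` that do not occur in the link get the default `0`; they have no weight there.
  set k : Ω i → ℝ := fun a => if ha : ∃ x : X.faces, X.Agree S x y ∧ x.1 i = a then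
    X.cexp (insert i S) g ha.choose else 0 with hk
  have h1 : ∀ x : X.faces, X.Agree S x y → k (x.1 i) = X.cexp (insert i S) g x := by
    intro x hx
    have hex : ∃ x' : X.faces, X.Agree S x' y ∧ x'.1 i = x.1 i := ⟨x, hx, rfl⟩
    simp only [hk, dif_pos hex]
    refine isJunta_cexp _ _ _ _ (agree_insert.2 ⟨hex.choose_spec.2, ?_⟩)
    exact hex.choose_spec.1.trans hx.symm
  have hcongr : ∀ (T : Finset (Fin d)) (a b : X.faces → ℝ) (y' : X.faces), S ⊆ T →
      X.Agree S y' y → (∀ x, X.Agree S x y → a x = b x) → X.cexp T a y' = X.cexp T b y' := by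
    intro T a b y' hST hy' hab
    rw [cexp_apply, cexp_apply]
    congr 1
    refine Finset.sum_congr rfl fun x _ => ?_
    split_ifs with hx
    · rw [hab x ((hx.mono hST).trans hy')]
    · rfl
  have h2 := hX k
  rw [l2norm, l2norm, ← Real.sqrt_sq hγ, ← Real.sqrt_mul (sq_nonneg γ), link_expect, link_expect,
    link_expect, Real.sqrt_le_sqrt_iff] at h2
  · convert h2 using 1
    · refine hcongr _ _ _ _ subset_rfl (Agree.refl _ _) fun x hx => ?_
      rw [link_walk y x hx, hcongr _ _ _ x (Finset.subset_insert j S) hx h1,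
        hcongr _ _ _ y subset_rfl (Agree.refl _ _) h1,
        cexp_cexp_of_subset (Finset.subset_insert i S)]
      simp [isJunta_cexp S g x y hx]
    · congr 1
      refine hcongr _ _ _ _ subset_rfl (Agree.refl _ _) fun x hx => ?_
      rw [h1 x hx]
      rfl
  · exact mul_nonneg (sq_nonneg γ) (cexp_nonneg (fun x => sq_nonneg _) y)

/-- Average the squared bound of each link over `x_S`. -/
theorem IsGammaProduct.nrm_insert_le {γ : ℝ} (hγ : 0 ≤ γ) (hX : X.IsGammaProduct γ)
    {i j : Fin d} (hi : i ∉ S) (hj : j ∉ S) (hij : i ≠ j) (g : X.faces → ℝ) :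
    X.nrm (X.cexp (insert j S) (X.cexp (insert i S) g) - X.cexp S g) ≤ γ * X.nrm g := by
  refine nrm_le_of_sq_le (mul_nonneg hγ (nrm_nonneg g)) ?_
  have h1 : X.cexp S ((X.cexp (insert j S) (X.cexp (insert i S) g) - X.cexp S g) ^ 2) ≤
      γ ^ 2 • X.cexp S (X.cexp (insert i S) g ^ 2) := fun y =>
    (hX S (S.restrict y.1) ⟨y.1, y.2, rfl⟩ i j hi hj hij).cexp_sq_le hγ y _ g
  have h2 := avg_mono h1
  rw [avg_cexp, map_smul, avg_cexp, smul_eq_mul, pow_two (X.cexp _ g), ← nrm_sq] at h2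
  rw [mul_pow, ← pow_two]
  refine h2.trans ?_
  have := nrm_cexp_le (insert i S) g
  have := nrm_nonneg (X.cexp (insert i S) g)
  gcongr

/-- The elements of `A` are added one at a time. Each costs `γ`, by expansion in the link over `S ∪
A` applied to `cexp (insert b S) g`, which conditioning on `insert b (S ∪ A)` leaves unchanged. -/
theorem IsGammaProduct.nrm_union_insert_le {γ : ℝ} (hγ : 0 ≤ γ) (hX : X.IsGammaProduct γ)
    {b : Fin d} (hb : b ∉ S) (A : Finset (Fin d)) (hbA : b ∉ A) (hSA : Disjoint S A)
    (g : X.faces → ℝ) :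
    X.nrm (X.cexp (S ∪ A) (X.cexp (insert b S) g) - X.cexp S g) ≤ A.card * γ * X.nrm g := by
  induction A using Finset.induction_on with
  | empty => simp [cexp_cexp_of_subset (Finset.subset_insert b S), nrm_zero]
  | insert a A ha ih =>
    rw [Finset.disjoint_insert_right] at hSA
    rw [Finset.mem_insert, not_or] at hbA
    have h1 := ih hbA.2 hSA.2
    set k := X.cexp (insert b S) g with hk
    have hkk : X.cexp (insert b (S ∪ A)) k = k := cexp_cexp_of_superset
      (Finset.insert_subset_insert b Finset.subset_union_left) g
    have h2 := hX.nrm_insert_le hγ (S := S ∪ A) (i := b) (j := a) (by simp [hb, hbA.2])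
      (by simp [hSA.1, ha]) hbA.1 k
    rw [hkk] at h2
    rw [Finset.union_insert, Finset.card_insert_of_notMem ha]
    have h3 : X.cexp (insert a (S ∪ A)) k - X.cexp S g =
        (X.cexp (insert a (S ∪ A)) k - X.cexp (S ∪ A) k) + (X.cexp (S ∪ A) k - X.cexp S g) := by
      abel
    rw [h3]
    refine (nrm_add_le _ _).trans ?_
    have h4 : γ * X.nrm k ≤ γ * X.nrm g := mul_le_mul_of_nonneg_left (nrm_cexp_le _ _) hγ
    push_cast
    linarith

/-- Now the elements of `B` are added one at a time, with base `S ∪ B`; the outer `cexp (S ∪ A)` is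
a contraction and does not enlarge the error. -/
theorem IsGammaProduct.nrm_union_union_le {γ : ℝ} (hγ : 0 ≤ γ) (hX : X.IsGammaProduct γ)
    (A B : Finset (Fin d)) (hSA : Disjoint S A) (hSB : Disjoint S B) (hAB : Disjoint A B)
    (g : X.faces → ℝ) :
    X.nrm (X.cexp (S ∪ A) (X.cexp (S ∪ B) g) - X.cexp S g) ≤
      B.card * (A.card * γ) * X.nrm g := by
  induction B using Finset.induction_on with
  | empty => simp [cexp_cexp_of_superset Finset.subset_union_left, nrm_zero]
  | insert b B hb ih =>
    rw [Finset.disjoint_insert_right] at hSB hAB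
    have h1 := ih hSB.2 hAB.2
    have h2 := hX.nrm_union_insert_le hγ (S := S ∪ B) (b := b) (by simp [hSB.1, hb]) A hAB.1
      (Finset.disjoint_union_left.2 ⟨hSA, hAB.2.symm⟩) g
    rw [Finset.union_insert, Finset.card_insert_of_notMem hb]
    have h3 : X.cexp (S ∪ A) (X.cexp (insert b (S ∪ B)) g) - X.cexp S g =
        X.cexp (S ∪ A) (X.cexp (S ∪ B ∪ A) (X.cexp (insert b (S ∪ B)) g) - X.cexp (S ∪ B) g) +
          (X.cexp (S ∪ A) (X.cexp (S ∪ B) g) - X.cexp S g) := by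
      rw [map_sub, cexp_cexp_of_subset (T := S ∪ B ∪ A)]
      · abel
      · exact Finset.union_subset_union_left Finset.subset_union_left
    rw [h3]
    refine (nrm_add_le _ _).trans ?_
    have h4 := nrm_cexp_le (S ∪ A)
      (X.cexp (S ∪ B ∪ A) (X.cexp (insert b (S ∪ B)) g) - X.cexp (S ∪ B) g)
    push_cast
    linarith

variable (X) in
/-- Conditional expectations on `S` and on `T` compose to the one on `S ∩ T`, up to `η` in the
operator norm. -/
def AlmostCommute (η : ℝ) : Prop :=
  ∀ (S T : Finset (Fin d)) (g : X.faces → ℝ),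
    X.nrm (X.cexp S (X.cexp T g) - X.cexp (S ∩ T) g) ≤ η * X.nrm g

theorem IsGammaProduct.almostCommute {γ : ℝ} (hγ : 0 ≤ γ) (hX : X.IsGammaProduct γ) :
    X.AlmostCommute ((d : ℝ) ^ 2 * γ) := by
  intro S T g
  have h1 := hX.nrm_union_union_le hγ (S := S ∩ T) (S \ T) (T \ S)
    (Finset.disjoint_left.2 fun x => by simp; tauto)
    (Finset.disjoint_left.2 fun x => by simp; tauto)
    (Finset.disjoint_left.2 fun x => by simp; tauto) g
  have h2 : S ∩ T ∪ S \ T = S := by ext; simp; tauto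
  have h3 : S ∩ T ∪ T \ S = T := by ext; simp; tauto
  rw [h2, h3] at h1
  refine h1.trans (mul_le_mul_of_nonneg_right ?_ (nrm_nonneg g))
  have h4 : ∀ U : Finset (Fin d), (U.card : ℝ) ≤ d := fun U => by
    exact_mod_cast (Finset.card_le_univ U).trans_eq (Fintype.card_fin d)
  have h5 := mul_le_mul (h4 (T \ S)) (mul_le_mul_of_nonneg_right (h4 (S \ T)) hγ)
    (by positivity) (by positivity)
  linarith

end PartiteComplex

/-! ### The approximate Efron–Stein decomposition -/

namespace PartiteComplex

variable {d : ℕ} {Ω : Fin d → Type*} [∀ i, Fintype (Ω i)] {X : PartiteComplex Ω}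
  {S T : Finset (Fin d)} {g h : X.faces → ℝ}

/-- The `R`-component in the approximate Efron–Stein decomposition of `f` relative to the
coordinates in `V`. -/
noncomputable def comp (f : X.faces → ℝ) (V R : Finset (Fin d)) : X.faces → ℝ :=
  ∑ T ∈ R.powerset, (-1 : ℝ) ^ (R \ T).card • X.cexp (V ∪ T) f

variable (f : X.faces → ℝ) (V R : Finset (Fin d))

theorem comp_empty : comp f V ∅ = X.cexp V f := by simp [comp]

/-- A component is an iterated difference, one coordinate at a time. Most inductions on components
run through this recursion, which is why the base `V` must vary. -/
theorem comp_insert {i : Fin d} (hi : i ∉ R) :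
    comp f V (insert i R) = comp f (insert i V) R - comp f V R := by
  rw [comp, Finset.sum_powerset_insert hi, comp, comp, add_comm, sub_eq_add_neg,
    ← Finset.sum_neg_distrib]
  congr 1 <;> refine Finset.sum_congr rfl fun T hT => ?_
  · rw [Finset.insert_sdiff_insert, Finset.sdiff_insert_of_notMem hi, Finset.union_insert,
      Finset.insert_union]
  · have hiT : i ∉ T := fun h => hi (Finset.mem_powerset.1 hT h)
    rw [Finset.insert_sdiff_of_notMem _ hiT, Finset.card_insert_of_notMem (by simp [hi]), pow_succ]
    simp

theorem isJunta_comp : X.IsJunta (V ∪ R) (comp f V R) := by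
  induction R using Finset.induction_on generalizing V with
  | empty => simpa [comp_empty] using isJunta_cexp V f
  | insert i R hi ih =>
    rw [comp_insert f V R hi]
    refine IsJunta.sub ?_ ((ih V).mono (by simp [Finset.union_insert]))
    simpa [Finset.union_insert, Finset.insert_union] using ih (insert i V)

variable {f} in
theorem abs_comp_le (hf : ∀ x, |f x| ≤ 1) (x : X.faces) : |comp f V R x| ≤ 2 ^ R.card := by
  induction R using Finset.induction_on generalizing V with
  | empty => simpa [comp_empty] using abs_cexp_le_of_bound hf x
  | insert i R hi ih =>
    rw [comp_insert f V R hi, Finset.card_insert_of_notMem hi, pow_succ, mul_two]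
    exact (abs_sub _ _).trans (add_le_add (ih _) (ih _))

theorem nrm_comp_le : X.nrm (comp f V R) ≤ 2 ^ R.card * X.nrm f := by
  induction R using Finset.induction_on generalizing V with
  | empty => simpa [comp_empty] using nrm_cexp_le V f
  | insert i R hi ih =>
    rw [comp_insert f V R hi, Finset.card_insert_of_notMem hi, pow_succ, mul_two, add_mul]
    exact (nrm_sub_le _ _).trans (add_le_add (ih _) (ih _))

/-- Möbius inversion, exact in any complex. -/
theorem sum_powerset_comp (Q : Finset (Fin d)) :
    ∑ R ∈ Q.powerset, comp f V R = X.cexp (V ∪ Q) f := by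
  induction Q using Finset.induction_on generalizing V with
  | empty => simp [comp_empty]
  | insert i Q hi ih =>
    rw [Finset.sum_powerset_insert hi, ← Finset.sum_add_distrib, Finset.union_insert,
      ← Finset.insert_union, ← ih]
    refine Finset.sum_congr rfl fun R hR => ?_
    rw [comp_insert f V R fun h => hi (Finset.mem_powerset.1 hR h)]
    abel

theorem sum_comp_compl : ∑ R ∈ Vᶜ.powerset, comp f V R = f := by
  rw [sum_powerset_comp, Finset.union_compl, cexp_univ]

theorem sum_comp : ∑ R, comp f ∅ R = f := by
  simpa using sum_comp_compl f ∅

variable {V R} {η : ℝ}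

/-- Averaging out `x_i` sends `cexp (insert i V) f` nearly to `cexp V f` and fixes the latter, so
the difference nearly dies. Each step of the recursion doubles the number of error terms. -/
theorem AlmostCommute.nrm_cexp_erase_comp_aux (hX : X.AlmostCommute η) {i : Fin d} (hV : i ∉ V)
    (hR : i ∉ R) : X.nrm (X.cexp (Finset.univ.erase i) (comp f (insert i V) R - comp f V R)) ≤
      2 ^ R.card * (η * X.nrm f) := by
  induction R using Finset.induction_on generalizing V with
  | empty =>
    have h1 : Finset.univ.erase i ∩ insert i V = V := by
      ext j; by_cases hj : j = i <;> simp [hj, hV]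
    have h2 := hX (Finset.univ.erase i) (insert i V) f
    rw [h1] at h2
    rw [comp_empty, comp_empty, map_sub, cexp_cexp_of_superset (S := V)]
    · simpa using h2
    · intro j hj
      exact Finset.mem_erase.2 ⟨fun h => hV (h ▸ hj), Finset.mem_univ j⟩
  | insert j R hj ih =>
    rw [Finset.mem_insert, not_or] at hR
    rw [comp_insert _ _ _ hj, comp_insert _ _ _ hj, Finset.insert_comm j i, sub_sub_sub_comm,
      Finset.card_insert_of_notMem hj, pow_succ, mul_two, add_mul, map_sub]
    exact (nrm_sub_le _ _).trans (add_le_add (ih (by simp [hV, hR.1]) hR.2) (ih hV hR.2))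

theorem two_pow_card_le (R : Finset (Fin d)) : (2 : ℝ) ^ R.card ≤ 2 ^ d :=
  pow_le_pow_right₀ one_le_two ((Finset.card_le_univ R).trans_eq (Fintype.card_fin d))

theorem AlmostCommute.nrm_cexp_erase_comp (hX : X.AlmostCommute η) (hη : 0 ≤ η) {i : Fin d}
    (hV : i ∉ V) (hR : i ∈ R) :
    X.nrm (X.cexp (Finset.univ.erase i) (comp f V R)) ≤ 2 ^ d * η * X.nrm f := by
  rw [← Finset.insert_erase hR, comp_insert _ _ _ (Finset.notMem_erase i R), mul_assoc]
  refine (hX.nrm_cexp_erase_comp_aux f hV (Finset.notMem_erase i R)).trans ?_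
  exact mul_le_mul_of_nonneg_right (two_pow_card_le _) (mul_nonneg hη (nrm_nonneg f))

/-- Some `i` lies in just one of `R`, `R'`. Conditioning on all other coordinates pulls out the
component without `i` and nearly kills the other one. -/
theorem AlmostCommute.avg_abs_cexp_mul_comp_le (hX : X.AlmostCommute η) (hη : 0 ≤ η)
    {R' : Finset (Fin d)} (hR : R ⊆ Vᶜ) (hR' : R' ⊆ Vᶜ) (hne : R ≠ R') :
    X.avg |X.cexp V (comp f V R * comp f V R')| ≤ 4 ^ d * η * X.nrm f ^ 2 := by
  wlog hw : ∃ i ∈ R, i ∉ R' generalizing R R'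
  · rw [mul_comm (comp f V R)]
    refine this hR' hR hne.symm ?_
    push Not at hw
    by_contra! hw'
    exact hne (Finset.Subset.antisymm hw hw')
  obtain ⟨i, hi, hi'⟩ := hw
  have hiV : i ∉ V := Finset.mem_compl.1 (hR hi)
  have hsub : ∀ {Q : Finset (Fin d)}, i ∉ Q → Q ⊆ Finset.univ.erase i := fun hQ j hj => by
    exact Finset.mem_erase.2 ⟨fun h => hQ (h ▸ hj), Finset.mem_univ j⟩
  rw [← cexp_cexp_of_subset (hsub hiV), mul_comm (comp f V R), cexp_mul_of_isJunta
    ((isJunta_comp f V R').mono (hsub (by simp [hi', hiV])))]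
  refine (avg_abs_cexp_le _ _).trans ((avg_abs_mul_le _ _).trans ?_)
  have h1 := hX.nrm_cexp_erase_comp f hη hiV hi
  have h2 := (nrm_comp_le f V R').trans
    (mul_le_mul_of_nonneg_right (two_pow_card_le R') (nrm_nonneg f))
  have h3 := nrm_nonneg f
  calc X.nrm (comp f V R') * X.nrm (X.cexp (Finset.univ.erase i) (comp f V R))
      ≤ (2 ^ d * X.nrm f) * (2 ^ d * η * X.nrm f) :=
        mul_le_mul h2 h1 (nrm_nonneg _) (by positivity)
    _ = 4 ^ d * η * X.nrm f ^ 2 := by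
        rw [show (4 : ℝ) = 2 * 2 by norm_num, mul_pow]; ring

theorem avg_abs_sum_le {ι : Type*} (s : Finset ι) (F : ι → X.faces → ℝ) :
    X.avg |∑ i ∈ s, F i| ≤ ∑ i ∈ s, X.avg |F i| := by
  rw [← map_sum]
  refine avg_mono fun x => ?_
  simp only [Pi.abs_apply, Finset.sum_apply]
  exact Finset.abs_sum_le_sum_abs _ _

variable (V) in
-- Approximate Parseval in the links of `x_V`: the off-diagonal terms of `f * f` are small on
-- average, although not necessarily in each link.
theorem AlmostCommute.avg_abs_energy_le (hX : X.AlmostCommute η) (hη : 0 ≤ η) :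
    X.avg |X.cexp V (f * f) - ∑ R ∈ Vᶜ.powerset, X.cexp V (comp f V R * comp f V R)| ≤
      16 ^ d * η * X.nrm f ^ 2 := by
  classical
  have h1 : X.cexp V (f * f) - ∑ R ∈ Vᶜ.powerset, X.cexp V (comp f V R * comp f V R) =
      ∑ R ∈ Vᶜ.powerset, ∑ R' ∈ Vᶜ.powerset.erase R, X.cexp V (comp f V R * comp f V R') := by
    conv_lhs => rw [← sum_comp_compl f V]
    rw [Finset.sum_mul_sum, map_sum, ← Finset.sum_sub_distrib]
    simp only [sum_comp_compl]
    refine Finset.sum_congr rfl fun R hR => ?_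
    rw [map_sum, ← Finset.add_sum_erase _ _ hR, add_sub_cancel_left]
  have hc : ∀ s : Finset (Finset (Fin d)), (s.card : ℝ) ≤ 2 ^ d := fun s => by
    exact_mod_cast (Finset.card_le_univ s).trans_eq (by simp)
  have hB : 0 ≤ 4 ^ d * η * X.nrm f ^ 2 := by positivity
  rw [h1]
  calc _ ≤ ∑ R ∈ Vᶜ.powerset, ∑ R' ∈ Vᶜ.powerset.erase R, 4 ^ d * η * X.nrm f ^ 2 := by
        refine (avg_abs_sum_le _ _).trans (Finset.sum_le_sum fun R hR => ?_)
        refine (avg_abs_sum_le _ _).trans (Finset.sum_le_sum fun R' hR' => ?_)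
        rw [Finset.mem_erase, Finset.mem_powerset] at hR'
        exact hX.avg_abs_cexp_mul_comp_le f hη (Finset.mem_powerset.1 hR) hR'.2 hR'.1.symm
    _ ≤ ∑ R ∈ Vᶜ.powerset, 2 ^ d * (4 ^ d * η * X.nrm f ^ 2) := by
        refine Finset.sum_le_sum fun R _ => ?_
        rw [Finset.sum_const, nsmul_eq_mul]
        exact mul_le_mul_of_nonneg_right (hc _) hB
    _ ≤ 2 ^ d * (2 ^ d * (4 ^ d * η * X.nrm f ^ 2)) := by
        rw [Finset.sum_const, nsmul_eq_mul]
        exact mul_le_mul_of_nonneg_right (hc _) (by positivity)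
    _ = _ := by
        rw [show (16 : ℝ) = 2 * (2 * 4) by norm_num, mul_pow, mul_pow]; ring

variable (X) in
/-- The total influence of a function on the faces. -/
noncomputable def infl (g : X.faces → ℝ) : ℝ :=
  ∑ i, X.avg (g * (g - X.cexp (Finset.univ.erase i) g))

/-- Near orthogonality makes `𝔼[f f_S]` equal to `‖f_S‖²` up to a small error. This replaces the
nonnegativity needed for a Markov argument on levels. -/
theorem AlmostCommute.neg_le_avg_mul_comp (hX : X.AlmostCommute η) (hη : 0 ≤ η)
    (S : Finset (Fin d)) : -(8 ^ d * η * X.nrm f ^ 2) ≤ X.avg (f * comp f ∅ S) := by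
  classical
  have h1 : X.avg (f * comp f ∅ S) = X.avg (comp f ∅ S * comp f ∅ S) +
      ∑ R ∈ Finset.univ.erase S, X.avg (comp f ∅ R * comp f ∅ S) := by
    rw [Finset.add_sum_erase _ (fun R => X.avg (comp f ∅ R * comp f ∅ S)) (Finset.mem_univ S),
      ← map_sum, ← Finset.sum_mul, sum_comp]
  have h2 : |∑ R ∈ Finset.univ.erase S, X.avg (comp f ∅ R * comp f ∅ S)| ≤
      8 ^ d * η * X.nrm f ^ 2 := by
    calc _ ≤ ∑ R ∈ Finset.univ.erase S, 4 ^ d * η * X.nrm f ^ 2 := by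
          refine (Finset.abs_sum_le_sum_abs _ _).trans (Finset.sum_le_sum fun R hR => ?_)
          have h3 := hX.avg_abs_cexp_mul_comp_le f hη (V := ∅) (R := R) (R' := S) (by simp)
            (by simp) (Finset.ne_of_mem_erase hR)
          refine le_trans ?_ h3
          rw [← avg_cexp ∅]
          exact abs_avg_le _
      _ ≤ 2 ^ d * (4 ^ d * η * X.nrm f ^ 2) := by
          rw [Finset.sum_const, nsmul_eq_mul]
          refine mul_le_mul_of_nonneg_right ?_ (by positivity)
          exact_mod_cast (Finset.card_le_univ _).trans_eq (by simp)
      _ = _ := by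
          rw [show (8 : ℝ) = 2 * 4 by norm_num, mul_pow]; ring
  have h3 := avg_mul_self_nonneg (comp f ∅ S)
  have h4 := (abs_le.1 h2).1
  linarith

/-- The Laplacian in direction `i` kills the components without `i` exactly and almost fixes the
others; summing over `i` counts each `S` exactly `|S|` times. -/
theorem AlmostCommute.sum_card_mul_le_infl (hX : X.AlmostCommute η) (hη : 0 ≤ η) :
    ∑ S : Finset (Fin d), S.card * X.avg (f * comp f ∅ S) ≤
      X.infl f + 8 ^ d * η * X.nrm f ^ 2 := by
  classical
  have h1 : ∀ i, ∑ S ∈ Finset.univ.filter (i ∈ ·), X.avg (f * comp f ∅ S) ≤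
      X.avg (f * (f - X.cexp (Finset.univ.erase i) f)) + 4 ^ d * η * X.nrm f ^ 2 := by
    intro i
    have h2 : f - X.cexp (Finset.univ.erase i) f = ∑ S ∈ Finset.univ.filter (i ∈ ·),
        (comp f ∅ S - X.cexp (Finset.univ.erase i) (comp f ∅ S)) := by
      conv_lhs => rw [← sum_comp f]
      rw [map_sum, ← Finset.sum_sub_distrib]
      refine (Finset.sum_subset (Finset.subset_univ _) fun S _ hS => ?_).symm
      have hiS : i ∉ S := by simpa using hS
      rw [cexp_of_isJunta, sub_self]
      refine (isJunta_comp f ∅ S).mono fun j hj => ?_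
      simp only [Finset.empty_union] at hj
      exact Finset.mem_erase.2 ⟨fun h => hiS (h ▸ hj), Finset.mem_univ j⟩
    have h3 : ∀ S ∈ Finset.univ.filter (i ∈ ·), X.avg (f * comp f ∅ S) - 2 ^ d * η * X.nrm f ^ 2 ≤
        X.avg (f * (comp f ∅ S - X.cexp (Finset.univ.erase i) (comp f ∅ S))) := by
      intro S hS
      have h4 := hX.nrm_cexp_erase_comp f hη (V := ∅) (by simp) (Finset.mem_filter.1 hS).2
      have h5 := (le_abs_self _).trans
        (abs_avg_mul_le f (X.cexp (Finset.univ.erase i) (comp f ∅ S)))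
      have h6 := mul_le_mul_of_nonneg_left h4 (nrm_nonneg f)
      rw [mul_sub, map_sub]
      linarith
    have h4 := Finset.sum_le_sum h3
    rw [Finset.sum_sub_distrib, ← map_sum, ← map_sum, ← Finset.mul_sum _ _ f, ← Finset.mul_sum _ _ f,
      ← h2, Finset.sum_const, nsmul_eq_mul] at h4
    have h5 : ((Finset.univ.filter (i ∈ ·) : Finset (Finset (Fin d))).card : ℝ) ≤ 2 ^ d := by
      exact_mod_cast (Finset.card_le_univ _).trans_eq (by simp)
    have h6 := mul_le_mul_of_nonneg_right h5 (show 0 ≤ 2 ^ d * η * X.nrm f ^ 2 by positivity)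
    rw [← map_sum, ← Finset.mul_sum]
    have h7 : (4 : ℝ) ^ d = 2 ^ d * 2 ^ d := by rw [← mul_pow]; norm_num
    rw [h7]
    linarith
  have h2 := Finset.sum_le_sum fun i (_ : i ∈ Finset.univ) => h1 i
  rw [Finset.sum_add_distrib, Finset.sum_const, nsmul_eq_mul, Finset.card_univ, Fintype.card_fin]
    at h2
  have h3 : ∑ i, ∑ S ∈ Finset.univ.filter (i ∈ ·), X.avg (f * comp f ∅ S) =
      ∑ S : Finset (Fin d), S.card * X.avg (f * comp f ∅ S) := by
    simp only [Finset.sum_filter]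
    rw [Finset.sum_comm]
    refine Finset.sum_congr rfl fun S _ => ?_
    rw [← Finset.sum_filter, Finset.sum_const, nsmul_eq_mul]
    simp
  rw [h3] at h2
  refine h2.trans (add_le_add le_rfl ?_)
  have h4 : (d : ℝ) ≤ 2 ^ d := by exact_mod_cast Nat.lt_two_pow_self.le
  have h5 : (8 : ℝ) ^ d = 2 ^ d * 4 ^ d := by rw [← mul_pow]; norm_num
  have h6 := mul_le_mul_of_nonneg_right h4 (show 0 ≤ 4 ^ d * η * X.nrm f ^ 2 by positivity)
  rw [h5]
  linarith

/-- Markov's inequality on the level weights, after adding `e` to each of them to make it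
nonnegative. -/
theorem AlmostCommute.mul_sum_filter_le (hX : X.AlmostCommute η) (hη : 0 ≤ η) (r : ℕ) :
    (r + 1) * ∑ S : Finset (Fin d) with r < S.card, X.avg (f * comp f ∅ S) ≤
      X.infl f + 2 * 32 ^ d * η * X.nrm f ^ 2 := by
  classical
  set e := 8 ^ d * η * X.nrm f ^ 2 with he
  have he0 : 0 ≤ e := by positivity
  have h0 : ∀ S : Finset (Fin d), 0 ≤ X.avg (f * comp f ∅ S) + e := fun S => by
    linarith [hX.neg_le_avg_mul_comp f hη S]
  have h1 : (r + 1) * ∑ S : Finset (Fin d) with r < S.card, X.avg (f * comp f ∅ S) ≤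
      ∑ S : Finset (Fin d), S.card * (X.avg (f * comp f ∅ S) + e) := by
    rw [Finset.mul_sum]
    refine (Finset.sum_le_sum fun S hS => ?_).trans
      (Finset.sum_le_sum_of_subset_of_nonneg (Finset.filter_subset _ _) fun S _ _ => ?_)
    · have h2 : (r : ℝ) + 1 ≤ S.card := by exact_mod_cast (Finset.mem_filter.1 hS).2
      calc _ ≤ (r + 1 : ℝ) * (X.avg (f * comp f ∅ S) + e) := by gcongr; linarith
        _ ≤ _ := mul_le_mul_of_nonneg_right h2 (h0 S)
    · exact mul_nonneg (Nat.cast_nonneg _) (h0 S)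
  have h2 := hX.sum_card_mul_le_infl f hη
  have h3 : ∑ S : Finset (Fin d), (S.card : ℝ) * e ≤ 4 ^ d * e := by
    calc _ ≤ ∑ S : Finset (Fin d), 2 ^ d * e := by
          refine Finset.sum_le_sum fun S _ => mul_le_mul_of_nonneg_right ?_ he0
          refine le_trans ?_ (two_pow_card_le S)
          exact_mod_cast Nat.lt_two_pow_self.le
      _ = 4 ^ d * e := by
          simp only [Finset.sum_const, nsmul_eq_mul, Finset.card_univ, Fintype.card_finset,
            Fintype.card_fin]
          rw [show (4 : ℝ) = 2 * 2 by norm_num, mul_pow]; push_cast; ring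
  have h4 : e ≤ 4 ^ d * e := le_mul_of_one_le_left he0 (one_le_pow₀ (by norm_num))
  have h5 : (32 : ℝ) ^ d = 4 ^ d * 8 ^ d := by rw [← mul_pow]; norm_num
  simp only [mul_add, Finset.sum_add_distrib] at h1
  rw [h5]
  linarith

end PartiteComplex

/-! ### Triples of sets covering every element at least twice -/

section Combinatorics

open Finset

theorem sum_triangle_le {ι : Type*} [Fintype ι] (p q s : ι → ι → ℝ) :
    ∑ a, ∑ b, ∑ c, p a b * (q b c * s a c) ≤
      √(∑ a, ∑ b, p a b ^ 2) * (√(∑ b, ∑ c, q b c ^ 2) * √(∑ a, ∑ c, s a c ^ 2)) := by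
  have h1 : ∀ a b, (∑ c, q b c * s a c) ^ 2 ≤ (∑ c, q b c ^ 2) * ∑ c, s a c ^ 2 :=
    fun a b => sum_mul_sq_le_sq_mul_sq _ _ _
  have h2 := Real.sum_mul_le_sqrt_mul_sqrt (univ : Finset (ι × ι)) (fun x => p x.1 x.2)
    (fun x => ∑ c, q x.2 c * s x.1 c)
  simp only [Fintype.sum_prod_type, mul_sum] at h2
  refine h2.trans (mul_le_mul_of_nonneg_left ?_ (Real.sqrt_nonneg _))
  rw [← Real.sqrt_mul (sum_nonneg fun b _ => sum_nonneg fun c _ => sq_nonneg _)]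
  refine Real.sqrt_le_sqrt ((sum_le_sum fun a _ => sum_le_sum fun b _ => h1 a b).trans_eq ?_)
  rw [sum_mul_sum, sum_comm]

theorem sum_le_sum_of_injOn {ι κ : Type*} [DecidableEq κ] {s : Finset ι} {t : Finset κ}
    (m : ι → κ) (hm : ∀ i ∈ s, m i ∈ t) (hinj : Set.InjOn m s) (F : ι → ℝ) (G : κ → ℝ)
    (hG : ∀ k ∈ t, 0 ≤ G k) (hFG : ∀ i ∈ s, F i = G (m i)) : ∑ i ∈ s, F i ≤ ∑ k ∈ t, G k := by
  rw [sum_congr rfl hFG, ← sum_image (g := m) (f := G) hinj]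
  exact sum_le_sum_of_subset_of_nonneg (image_subset_iff.2 hm) fun k hk _ => hG k hk

variable {α : Type*} [DecidableEq α]

/-- No element belongs to exactly one of the three sets. -/
def CoverTwice (x : Finset α × Finset α × Finset α) : Prop :=
  x.1 ⊆ x.2.1 ∪ x.2.2 ∧ x.2.1 ⊆ x.1 ∪ x.2.2 ∧ x.2.2 ⊆ x.1 ∪ x.2.1

instance : DecidablePred (CoverTwice (α := α)) := fun x => by unfold CoverTwice; infer_instance

/-- Without elements in exactly one set, each set is the union of the common part `W` and the two
pairwise parts that it meets. -/
theorem CoverTwice.reconstruct {x : Finset α × Finset α × Finset α} {W : Finset α}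
    (hx : CoverTwice x) (hW : x.1 ∩ x.2.1 ∩ (x.1 ∩ x.2.2) = W) :
    W ∪ (x.1 ∩ x.2.2) \ x.2.1 ∪ (x.1 ∩ x.2.1) \ x.2.2 = x.1 ∧
      W ∪ (x.1 ∩ x.2.1) \ x.2.2 ∪ (x.2.1 ∩ x.2.2) \ x.1 = x.2.1 ∧
      W ∪ (x.1 ∩ x.2.2) \ x.2.1 ∪ (x.2.1 ∩ x.2.2) \ x.1 = x.2.2 := by
  obtain ⟨U, S, T⟩ := x
  obtain ⟨c1, c2, c3⟩ := hx
  simp only at c1 c2 c3 hW ⊢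
  subst hW
  refine ⟨?_, ?_, ?_⟩ <;> ext i
  · have := @c1 i
    simp only [mem_union, mem_inter, mem_sdiff] at *
    tauto
  · have := @c2 i
    simp only [mem_union, mem_inter, mem_sdiff] at *
    tauto
  · have := @c3 i
    simp only [mem_union, mem_inter, mem_sdiff] at *
    tauto

variable [Fintype α]

/-- A pair `(A, B)` is recovered from `S = W ∪ A ∪ B` and `A ⊆ S`, so the weight `2 ^ |S|` pays for
the choice of `A`. -/
theorem sum_disjoint_pairs_le (W : Finset α) (N : Finset α → ℝ) :
    ∑ A : Finset α, ∑ B : Finset α,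
      (if Disjoint A B ∧ Disjoint W A ∧ Disjoint W B then N (W ∪ A ∪ B) else 0) ^ 2 ≤
        ∑ S with W ⊆ S, 2 ^ S.card * N S ^ 2 := by
  have h1 : ∑ S with W ⊆ S, 2 ^ S.card * N S ^ 2 =
      ∑ x ∈ (univ.filter (W ⊆ ·)).sigma fun S => S.powerset, N x.1 ^ 2 := by
    rw [sum_sigma]
    refine sum_congr rfl fun S _ => ?_
    simp
  rw [h1, ← Fintype.sum_prod_type' (f := fun A B =>
    (if Disjoint A B ∧ Disjoint W A ∧ Disjoint W B then N (W ∪ A ∪ B) else 0) ^ 2)]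
  simp only [ite_pow, ne_eq, OfNat.ofNat_ne_zero, not_false_eq_true, zero_pow]
  rw [← sum_filter]
  refine sum_le_sum_of_injOn (fun x => ⟨W ∪ x.1 ∪ x.2, x.1⟩) ?_ ?_ _ _
    (fun _ _ => sq_nonneg _) fun _ _ => rfl
  · intro x _
    simp only [mem_sigma, mem_filter, mem_univ, true_and, mem_powerset]
    exact ⟨by grind, by grind⟩
  · rintro ⟨A, B⟩ hx ⟨A', B'⟩ hx' h
    simp only [coe_filter, mem_univ, true_and, Set.mem_ofPred_eq] at hx hx'
    simp only [Sigma.mk.injEq, heq_eq_eq] at h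
    obtain ⟨h2, rfl⟩ := h
    have hB : B = (W ∪ A ∪ B) \ (W ∪ A) := by
      rw [union_sdiff_cancel_left (disjoint_union_left.2 ⟨hx.2.2, hx.1⟩)]
    have hB' : B' = (W ∪ A ∪ B') \ (W ∪ A) := by
      rw [union_sdiff_cancel_left (disjoint_union_left.2 ⟨hx'.2.2, hx'.1⟩)]
    rw [hB, hB', h2]

/-- The three pairwise parts are the vertices of a triangle whose edges carry the three sets, so
`sum_triangle_le` applies to the kernel `p A B = N (W ∪ A ∪ B)`. -/
theorem sum_coverTwice_le (W : Finset α) (N : Finset α → ℝ) (hN : ∀ S, 0 ≤ N S) :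
    ∑ x : Finset α × Finset α × Finset α with CoverTwice x ∧ x.1 ∩ x.2.1 ∩ (x.1 ∩ x.2.2) = W,
      N x.1 * (N x.2.1 * N x.2.2) ≤ √(∑ S with W ⊆ S, 2 ^ S.card * N S ^ 2) ^ 3 := by
  set p : Finset α → Finset α → ℝ := fun A B =>
    if Disjoint A B ∧ Disjoint W A ∧ Disjoint W B then N (W ∪ A ∪ B) else 0 with hp
  have hp0 : ∀ A B, 0 ≤ p A B := fun A B => by
    simp only [hp]; split_ifs
    exacts [hN _, le_rfl]
  have h1 := sum_triangle_le p p p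
  have h2 := Real.sqrt_le_sqrt (sum_disjoint_pairs_le W N)
  set Q := √(∑ S with W ⊆ S, 2 ^ S.card * N S ^ 2)
  have h3 : ∑ a, ∑ b, ∑ c, p a b * (p b c * p a c) ≤ Q ^ 3 := by
    refine h1.trans ?_
    have h4 := Real.sqrt_nonneg (∑ a, ∑ b, p a b ^ 2)
    calc _ ≤ Q * (Q * Q) := by gcongr
      _ = Q ^ 3 := by ring
  refine le_trans ?_ h3
  have h5 : ∑ a, ∑ b, ∑ c, p a b * (p b c * p a c) =
      ∑ y : Finset α × Finset α × Finset α, p y.1 y.2.1 * (p y.2.1 y.2.2 * p y.1 y.2.2) := by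
    simp only [Fintype.sum_prod_type]
  rw [h5]
  refine sum_le_sum_of_injOn
    (fun x => ((x.1 ∩ x.2.2) \ x.2.1, (x.1 ∩ x.2.1) \ x.2.2, (x.2.1 ∩ x.2.2) \ x.1))
    (fun _ _ => mem_univ _) ?_ _ _ (fun y _ => mul_nonneg (hp0 _ _) (mul_nonneg (hp0 _ _)
    (hp0 _ _))) ?_
  · rintro ⟨U, S, T⟩ hx ⟨U', S', T'⟩ hx' h
    replace hx := (mem_filter.1 (mem_coe.1 hx)).2
    replace hx' := (mem_filter.1 (mem_coe.1 hx')).2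
    simp only [Prod.mk.injEq] at h ⊢
    obtain ⟨⟨c1, c2, c3⟩, hW⟩ := hx
    obtain ⟨⟨c1', c2', c3'⟩, hW'⟩ := hx'
    obtain ⟨e1, e2, e3⟩ := h
    obtain ⟨a1, a2, a3⟩ := CoverTwice.reconstruct ⟨c1, c2, c3⟩ hW
    obtain ⟨b1, b2, b3⟩ := CoverTwice.reconstruct ⟨c1', c2', c3'⟩ hW'
    simp only at a1 a2 a3 b1 b2 b3
    refine ⟨?_, ?_, ?_⟩
    · rw [← a1, ← b1, e1, e2]
    · rw [← a2, ← b2, e2, e3]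
    · rw [← a3, ← b3, e1, e3]
  · rintro ⟨U, S, T⟩ hx
    replace hx := (mem_filter.1 hx).2
    obtain ⟨hc, hW⟩ := hx
    obtain ⟨e1, e2, e3⟩ := hc.reconstruct hW
    simp only at e1 e2 e3
    clear hc
    have d1 : Disjoint ((U ∩ T) \ S) ((U ∩ S) \ T) := disjoint_left.2 fun i => by simp; tauto
    have d2 : Disjoint ((U ∩ S) \ T) ((S ∩ T) \ U) := disjoint_left.2 fun i => by simp; tauto
    have d3 : Disjoint ((U ∩ T) \ S) ((S ∩ T) \ U) := disjoint_left.2 fun i => by simp; tauto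
    have f1 : Disjoint W ((U ∩ T) \ S) := disjoint_left.2 fun i => by rw [← hW]; simp +contextual
    have f2 : Disjoint W ((U ∩ S) \ T) := disjoint_left.2 fun i => by rw [← hW]; simp +contextual
    have f3 : Disjoint W ((S ∩ T) \ U) := disjoint_left.2 fun i => by rw [← hW]; simp +contextual
    simp only [hp]
    rw [if_pos ⟨d1, f1, f2⟩, if_pos ⟨d2, f2, f3⟩, if_pos ⟨d3, f1, f3⟩, e1, e2, e3]

end Combinatorics

/-! ### Averages of triple products -/

theorem sqrt_le_sqrt_add_sqrt_abs_sub (a b : ℝ) : √a ≤ √b + √|a - b| := by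
  rcases le_or_gt b 0 with hb | hb
  · rw [Real.sqrt_eq_zero_of_nonpos hb, zero_add]
    rcases le_or_gt a 0 with ha | ha
    · rw [Real.sqrt_eq_zero_of_nonpos ha]; exact Real.sqrt_nonneg _
    · exact Real.sqrt_le_sqrt (by linarith [le_abs_self (a - b)])
  · refine Real.sqrt_le_iff.2 ⟨by positivity, ?_⟩
    have h1 := Real.sq_sqrt hb.le
    have h2 := Real.sq_sqrt (abs_nonneg (a - b))
    have h3 := le_abs_self (a - b)
    have h4 := mul_nonneg (Real.sqrt_nonneg b) (Real.sqrt_nonneg |a - b|)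
    nlinarith

namespace PartiteComplex

variable {d : ℕ} {Ω : Fin d → Type*} [∀ i, Fintype (Ω i)] {X : PartiteComplex Ω}
  {S T U : Finset (Fin d)} {g h : X.faces → ℝ}

theorem nrm_sqrt (hg : 0 ≤ g) : X.nrm (fun x => √(g x)) = √(X.avg g) := by
  rw [nrm]
  congr 2
  ext x
  exact Real.mul_self_sqrt (hg x)

theorem avg_mul_sqrt_le (g h : X.faces → ℝ) (hh : 0 ≤ h) :
    X.avg (g * fun x => √(h x)) ≤ X.nrm g * √(X.avg h) := by
  rw [← nrm_sqrt hh]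
  exact (le_abs_self _).trans (abs_avg_mul_le _ _)

variable {η D : ℝ} {u v w : X.faces → ℝ}

theorem AlmostCommute.avg_abs_cexp_mul_cexp_sub_le (hX : X.AlmostCommute η) (hη : 0 ≤ η)
    (hv : X.IsJunta S v) (hw : X.IsJunta T w) (hvD : ∀ x, |v x| ≤ D) (hwD : ∀ x, |w x| ≤ D) :
    X.avg |X.cexp U (v * v) * X.cexp U (w * w) -
      X.cexp (U ∩ S) (v * v) * X.cexp (U ∩ T) (w * w)| ≤
        2 * (η * (D * X.nrm v) * (D * X.nrm w)) := by
  have h1 := hX U S (v * v)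
  have h2 := hX U T (w * w)
  rw [cexp_of_isJunta (hv.mul hv)] at h1
  rw [cexp_of_isJunta (hw.mul hw)] at h2
  have h3 := nrm_mul_le hvD v
  have h4 := nrm_mul_le hwD w
  have h5 := (nrm_cexp_le U (w * w)).trans h4
  have h6 := (nrm_cexp_le (U ∩ S) (v * v)).trans h3
  have h7 := h1.trans (mul_le_mul_of_nonneg_left h3 hη)
  have h8 := h2.trans (mul_le_mul_of_nonneg_left h4 hη)
  have h9 : X.cexp U (v * v) * X.cexp U (w * w) -
      X.cexp (U ∩ S) (v * v) * X.cexp (U ∩ T) (w * w) =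
      (X.cexp U (v * v) - X.cexp (U ∩ S) (v * v)) * X.cexp U (w * w) +
        X.cexp (U ∩ S) (v * v) * (X.cexp U (w * w) - X.cexp (U ∩ T) (w * w)) := by ring
  have h10 := (nrm_nonneg _).trans h3
  have h11 := (nrm_nonneg _).trans h4
  rw [h9]
  calc _ ≤ X.avg (|(X.cexp U (v * v) - X.cexp (U ∩ S) (v * v)) * X.cexp U (w * w)| +
        |X.cexp (U ∩ S) (v * v) * (X.cexp U (w * w) - X.cexp (U ∩ T) (w * w))|) :=
        avg_mono fun x => abs_add_le _ _
    _ ≤ (η * (D * X.nrm v)) * (D * X.nrm w) + (D * X.nrm v) * (η * (D * X.nrm w)) := by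
        rw [map_add]
        refine add_le_add ((avg_abs_mul_le _ _).trans ?_) ((avg_abs_mul_le _ _).trans ?_)
        · exact mul_le_mul h7 h5 (nrm_nonneg _) (by positivity)
        · exact mul_le_mul h6 h8 (nrm_nonneg _) h10
    _ = _ := by ring

/-- By the tower property `B` may first be conditioned on `A`, and `cexp A` after `cexp B` is nearly
`cexp (A ∩ B)`, which pulls out. -/
theorem AlmostCommute.avg_abs_cexp_cexp_mul_sub_le (hX : X.AlmostCommute η) (hη : 0 ≤ η)
    (A B : Finset (Fin d)) (hvD : ∀ x, |v x| ≤ D) (hwD : ∀ x, |w x| ≤ D) :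
    X.avg |X.cexp (A ∩ B) (X.cexp A (v * v) * X.cexp B (w * w)) -
      X.cexp (A ∩ B) (v * v) * X.cexp (A ∩ B) (w * w)| ≤ η * (D * X.nrm v) * (D * X.nrm w) := by
  have h1 : X.cexp (A ∩ B) (X.cexp A (v * v) * X.cexp B (w * w)) -
      X.cexp (A ∩ B) (v * v) * X.cexp (A ∩ B) (w * w) = X.cexp (A ∩ B) (X.cexp A (v * v) *
        (X.cexp A (X.cexp B (w * w)) - X.cexp (A ∩ B) (w * w))) := by
    rw [mul_sub, map_sub, ← cexp_mul_of_isJunta (isJunta_cexp A (v * v)),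
      cexp_cexp_of_subset Finset.inter_subset_left, mul_comm _ (X.cexp (A ∩ B) (w * w)),
      mul_comm _ (X.cexp (A ∩ B) (w * w)), cexp_mul_of_isJunta (isJunta_cexp _ _),
      cexp_cexp_of_subset Finset.inter_subset_left]
  have h2 := hX A B (w * w)
  have h3 := nrm_mul_le hvD v
  have h4 := nrm_mul_le hwD w
  rw [h1]
  refine (avg_abs_cexp_le _ _).trans ((avg_abs_mul_le _ _).trans ?_)
  calc _ ≤ (D * X.nrm v) * (η * (D * X.nrm w)) :=
        mul_le_mul ((nrm_cexp_le _ _).trans h3) (h2.trans (mul_le_mul_of_nonneg_left h4 hη))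
          (nrm_nonneg _) ((nrm_nonneg _).trans h3)
    _ = _ := by ring

/-- Cauchy–Schwarz is used twice. Given `x_U` it separates `v` from `w`, whose conditional energies
then depend almost only on `U ∩ S` and `U ∩ T`; given `x_W` it separates `u` from these energies,
which are almost independent. Errors under a root are peeled off, hence the `√η` loss. -/
theorem AlmostCommute.abs_avg_mul_mul_le (hX : X.AlmostCommute η) (hη : 0 ≤ η)
    (hu : X.IsJunta U u) (hv : X.IsJunta S v) (hw : X.IsJunta T w)
    (hvD : ∀ x, |v x| ≤ D) (hwD : ∀ x, |w x| ≤ D) :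
    |X.avg (u * (v * w))| ≤ X.avg (fun x => √(X.cexp (U ∩ S ∩ (U ∩ T)) (u * u) x) *
      (√(X.cexp (U ∩ S ∩ (U ∩ T)) (v * v) x) * √(X.cexp (U ∩ S ∩ (U ∩ T)) (w * w) x))) +
        3 * X.nrm u * √(η * (D * X.nrm v) * (D * X.nrm w)) := by
  have hsq : ∀ (A : Finset (Fin d)) (k : X.faces → ℝ), 0 ≤ X.cexp A (k * k) := fun A k =>
    cexp_nonneg fun x => mul_self_nonneg _
  set e := η * (D * X.nrm v) * (D * X.nrm w) with he
  set W := U ∩ S ∩ (U ∩ T) with hW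
  set P := X.cexp (U ∩ S) (v * v)
  set Q := X.cexp (U ∩ T) (w * w)
  set F := |X.cexp U (v * v) * X.cexp U (w * w) - P * Q| with hF
  set G := |X.cexp W (P * Q) - X.cexp W (v * v) * X.cexp W (w * w)| with hG
  have hFe : X.avg F ≤ 2 * e := hX.avg_abs_cexp_mul_cexp_sub_le hη hv hw hvD hwD
  have hGe : X.avg G ≤ e := hX.avg_abs_cexp_cexp_mul_sub_le hη _ _ hvD hwD
  have hF0 : 0 ≤ F := abs_nonneg _
  have hG0 : 0 ≤ G := abs_nonneg _
  have h1 : |X.avg (u * (v * w))| ≤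
      X.avg (|u| * fun x => √((P * Q) x)) + X.avg (|u| * fun x => √(F x)) := by
    rw [← avg_cexp U, cexp_mul_of_isJunta hu, ← map_add]
    refine (abs_avg_le _).trans (avg_mono fun x => ?_)
    simp only [Pi.abs_apply, Pi.mul_apply, Pi.add_apply, abs_mul, ← mul_add]
    refine mul_le_mul_of_nonneg_left ?_ (abs_nonneg _)
    refine (Real.abs_le_sqrt (cexp_mul_sq_le U v w x)).trans ?_
    exact sqrt_le_sqrt_add_sqrt_abs_sub _ _
  have h2 : X.avg (|u| * fun x => √(F x)) ≤ X.nrm u * √(2 * e) := by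
    refine (avg_mul_sqrt_le _ _ hF0).trans ?_
    rw [nrm_abs]
    exact mul_le_mul_of_nonneg_left (Real.sqrt_le_sqrt hFe) (nrm_nonneg _)
  have h3 : X.avg (|u| * fun x => √((P * Q) x)) ≤
      X.avg (fun x => √(X.cexp W (u * u) x) *
        (√(X.cexp W (v * v) x) * √(X.cexp W (w * w) x))) +
      X.avg ((fun x => √(X.cexp W (u * u) x)) * fun x => √(G x)) := by
    rw [← avg_cexp W, ← map_add]
    refine avg_mono fun x => ?_
    have h4 := cexp_mul_sq_le W |u| (fun x => √((P * Q) x)) x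
    have h5 : |u| * |u| = u * u := funext fun x => abs_mul_abs_self (u x)
    have h6 : (fun x => √((P * Q) x)) * (fun x => √((P * Q) x)) = P * Q :=
      funext fun x => Real.mul_self_sqrt (mul_nonneg (hsq _ _ x) (hsq _ _ x))
    rw [h5, h6] at h4
    simp only [Pi.mul_apply, Pi.add_apply, ← mul_add]
    refine ((le_abs_self _).trans (Real.abs_le_sqrt h4)).trans ?_
    rw [Real.sqrt_mul (hsq _ _ x), ← Real.sqrt_mul (hsq W v x)]
    exact mul_le_mul_of_nonneg_left (sqrt_le_sqrt_add_sqrt_abs_sub _ _) (Real.sqrt_nonneg _)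
  have h4 : X.avg ((fun x => √(X.cexp W (u * u) x)) * fun x => √(G x)) ≤ X.nrm u * √e := by
    refine (avg_mul_sqrt_le _ _ hG0).trans ?_
    rw [nrm_sqrt (hsq _ _), avg_cexp]
    exact mul_le_mul_of_nonneg_left (Real.sqrt_le_sqrt hGe) (nrm_nonneg _)
  have h5 : √(2 * e) ≤ 2 * √e := by
    rw [Real.sqrt_mul zero_le_two]
    refine mul_le_mul_of_nonneg_right ?_ (Real.sqrt_nonneg e)
    exact Real.sqrt_le_iff.2 ⟨zero_le_two, by norm_num⟩
  have h6 := mul_le_mul_of_nonneg_left h5 (nrm_nonneg u)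
  linarith

end PartiteComplex

/-! ### Energies in links of global functions -/

namespace PartiteComplex

variable {d : ℕ} {Ω : Fin d → Type*} [∀ i, Fintype (Ω i)] {X : PartiteComplex Ω}
  {S T U : Finset (Fin d)} {η : ℝ}

/-- Unfolding the differences along `W` gives a signed sum of `2 ^ |W|` components based at `V ∪
V'`; the rest is Cauchy–Schwarz, in the form `(a - b)² ≤ 2a² + 2b²` at each step. -/
theorem comp_union_sq_le (f : X.faces → ℝ) (V W R : Finset (Fin d)) (hWR : Disjoint W R)
    (x : X.faces) :
    comp f V (W ∪ R) x ^ 2 ≤ 2 ^ W.card * ∑ V' ∈ W.powerset, comp f (V ∪ V') R x ^ 2 := by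
  induction W using Finset.induction_on generalizing V with
  | empty => simp
  | insert i W hi ih =>
    rw [Finset.disjoint_insert_left] at hWR
    have h1 := ih (insert i V) hWR.2
    have h2 := ih V hWR.2
    rw [Finset.insert_union, comp_insert _ _ _ (by simp [hi, hWR.1]),
      Finset.sum_powerset_insert hi, Finset.card_insert_of_notMem hi, pow_succ (2 : ℝ)]
    simp only [Finset.union_insert, ← Finset.insert_union, Pi.sub_apply]
    nlinarith [sq_nonneg (comp f (insert i V) (W ∪ R) x + comp f V (W ∪ R) x)]

variable (f : X.faces → ℝ)

/-- The conditional energy, given the coordinates in `W`, of the components of `f` of degree at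
most `m` that involve all coordinates in `W`; a component of degree `k` has the factor `2 ^ k`. -/
noncomputable def linkEnergy (m : ℕ) (W : Finset (Fin d)) : X.faces → ℝ :=
  ∑ S with W ⊆ S ∧ S.card ≤ m, (2 : ℝ) ^ S.card • X.cexp W (comp f ∅ S * comp f ∅ S)

/-- The error in comparing the energy of `f` in the link of `x_V` with its average
given `x_W`. -/
noncomputable def energyError (V W : Finset (Fin d)) : X.faces → ℝ :=
  |X.cexp V (f * f) - ∑ R ∈ Vᶜ.powerset, X.cexp V (comp f V R * comp f V R)| +
    ∑ R ∈ Wᶜ.powerset,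
      |X.cexp W (comp f V R * comp f V R) - X.cexp V (comp f V R * comp f V R)|

theorem cexp_mul_self_nonneg (S : Finset (Fin d)) (g : X.faces → ℝ) : 0 ≤ X.cexp S (g * g) :=
  cexp_nonneg fun x => mul_self_nonneg (g x)

theorem linkEnergy_nonneg (m : ℕ) (W : Finset (Fin d)) : 0 ≤ linkEnergy f m W :=
  Finset.sum_nonneg fun S _ => smul_nonneg (by positivity) (cexp_mul_self_nonneg _ _)

/-- For `R` disjoint from `W`, `comp f V R` depends on `V ∪ R`, which meets `W` only in `V`. So
`cexp W` of its square is nearly `cexp V`, and Parseval in the link of `x_V` bounds the sum. The two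
losses make up `energyError`, controlled only on average. -/
theorem sum_cexp_comp_le (V W : Finset (Fin d)) (hVW : V ⊆ W) (x : X.faces) :
    ∑ R ∈ Wᶜ.powerset, X.cexp W (comp f V R * comp f V R) x ≤
      X.cexp V (f * f) x + energyError f V W x := by
  have h1 : ∑ R ∈ Wᶜ.powerset, X.cexp V (comp f V R * comp f V R) x ≤
      ∑ R ∈ Vᶜ.powerset, X.cexp V (comp f V R * comp f V R) x :=
    Finset.sum_le_sum_of_subset_of_nonneg
      (Finset.powerset_mono.2 (Finset.compl_subset_compl.2 hVW))
      fun R _ _ => cexp_mul_self_nonneg _ _ x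
  have h2 := neg_abs_le (X.cexp V (f * f) x -
    ∑ R ∈ Vᶜ.powerset, X.cexp V (comp f V R * comp f V R) x)
  have h3 : ∑ R ∈ Wᶜ.powerset, X.cexp W (comp f V R * comp f V R) x ≤
      ∑ R ∈ Wᶜ.powerset, X.cexp V (comp f V R * comp f V R) x + ∑ R ∈ Wᶜ.powerset,
        |X.cexp W (comp f V R * comp f V R) x - X.cexp V (comp f V R * comp f V R) x| := by
    rw [← Finset.sum_add_distrib]
    exact Finset.sum_le_sum fun R _ => by
      linarith [le_abs_self (X.cexp W (comp f V R * comp f V R) x -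
        X.cexp V (comp f V R * comp f V R) x)]
  simp only [energyError, Pi.add_apply, Pi.abs_apply, Pi.sub_apply, Finset.sum_apply]
  linarith

theorem linkEnergy_le (m : ℕ) (W : Finset (Fin d)) (x : X.faces) :
    linkEnergy f m W x ≤ 4 ^ m * ∑ V ∈ W.powerset, ∑ R ∈ Wᶜ.powerset,
      X.cexp W (comp f V R * comp f V R) x := by
  have h1 : ∀ S ∈ Finset.univ.filter (fun S : Finset (Fin d) => W ⊆ S ∧ S.card ≤ m),
      (2 : ℝ) ^ S.card * X.cexp W (comp f ∅ S * comp f ∅ S) x ≤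
        4 ^ m * ∑ V ∈ W.powerset, X.cexp W (comp f V (S \ W) * comp f V (S \ W)) x := by
    intro S hS
    obtain ⟨hWS, hSm⟩ := (Finset.mem_filter.1 hS).2
    have h2 : comp f ∅ S * comp f ∅ S ≤
        (2 : ℝ) ^ W.card • ∑ V ∈ W.powerset, comp f V (S \ W) * comp f V (S \ W) := by
      intro y
      have h3 := comp_union_sq_le f ∅ W (S \ W) Finset.disjoint_sdiff y
      rw [Finset.union_sdiff_of_subset hWS] at h3
      simpa [← pow_two] using h3
    have h3 := cexp_mono (S := W) h2 x
    rw [map_smul, map_sum] at h3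
    simp only [Pi.smul_apply, Finset.sum_apply, smul_eq_mul] at h3
    have h4 : 0 ≤ ∑ V ∈ W.powerset, X.cexp W (comp f V (S \ W) * comp f V (S \ W)) x :=
      Finset.sum_nonneg fun V _ => cexp_mul_self_nonneg _ _ x
    have h5 : (2 : ℝ) ^ S.card ≤ 2 ^ m := pow_le_pow_right₀ one_le_two hSm
    have h6 : (2 : ℝ) ^ W.card ≤ 2 ^ m :=
      pow_le_pow_right₀ one_le_two ((Finset.card_le_card hWS).trans hSm)
    calc _ ≤ (2 : ℝ) ^ S.card * (2 ^ W.card * _) := mul_le_mul_of_nonneg_left h3 (by positivity)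
      _ ≤ 2 ^ m * (2 ^ m * _) := mul_le_mul h5 (mul_le_mul_of_nonneg_right h6 h4)
          (by positivity) (by positivity)
      _ = _ := by rw [← mul_assoc, ← mul_pow]; norm_num
  simp only [linkEnergy, Finset.sum_apply, Pi.smul_apply, smul_eq_mul]
  refine (Finset.sum_le_sum h1).trans ?_
  rw [← Finset.mul_sum, Finset.sum_comm (s := W.powerset) (t := Wᶜ.powerset)]
  refine mul_le_mul_of_nonneg_left ?_ (by positivity)
  refine sum_le_sum_of_injOn (fun S => S \ W) ?_ ?_ _ _
    (fun R _ => Finset.sum_nonneg fun V _ => cexp_mul_self_nonneg _ _ x) fun _ _ => rfl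
  · intro S _
    rw [Finset.mem_powerset]
    exact fun i hi => Finset.mem_compl.2 (Finset.mem_sdiff.1 hi).2
  · intro S hS S' hS' h
    have hS := (Finset.mem_filter.1 (Finset.mem_coe.1 hS)).2.1
    have hS' := (Finset.mem_filter.1 (Finset.mem_coe.1 hS')).2.1
    rw [← Finset.union_sdiff_of_subset hS, ← Finset.union_sdiff_of_subset hS']
    exact congrArg (W ∪ ·) h

/-- Each of the at most `2 ^ m` sets `V ⊆ W` contributes its density, at most `δ`. For `|W| > m` no
component is counted. -/
theorem linkEnergy_le_of_global {m : ℕ} {δ : ℝ} (hδ : 0 ≤ δ)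
    (hglob : ∀ V : Finset (Fin d), V.card ≤ m → ∀ x, X.cexp V (f * f) x ≤ δ)
    (W : Finset (Fin d)) (x : X.faces) :
    linkEnergy f m W x ≤ 8 ^ m * δ + 4 ^ m * ∑ V ∈ W.powerset, energyError f V W x := by
  have hE : ∀ V, 0 ≤ energyError f V W x := fun V =>
    add_nonneg (abs_nonneg _) (by
      rw [Finset.sum_apply]; exact Finset.sum_nonneg fun _ _ => abs_nonneg _)
  rcases lt_or_ge m W.card with hW | hW
  · have h1 : linkEnergy f m W x = 0 := by
      rw [linkEnergy, Finset.filter_false_of_mem]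
      · rfl
      · exact fun S _ h => absurd ((Finset.card_le_card h.1).trans h.2) (by omega)
    rw [h1]
    exact add_nonneg (by positivity)
      (mul_nonneg (by positivity) (Finset.sum_nonneg fun V _ => hE V))
  · refine (linkEnergy_le f m W x).trans ?_
    have h1 : ∀ V ∈ W.powerset, ∑ R ∈ Wᶜ.powerset, X.cexp W (comp f V R * comp f V R) x ≤
        δ + energyError f V W x := by
      intro V hV
      rw [Finset.mem_powerset] at hV
      have := hglob V ((Finset.card_le_card hV).trans hW) x
      linarith [sum_cexp_comp_le f V W hV x]
    have h2 := Finset.sum_le_sum h1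
    rw [Finset.sum_add_distrib, Finset.sum_const, Finset.card_powerset, nsmul_eq_mul] at h2
    have h3 : ((2 ^ W.card : ℕ) : ℝ) * δ ≤ 2 ^ m * δ := by
      push_cast
      exact mul_le_mul_of_nonneg_right (pow_le_pow_right₀ one_le_two hW) hδ
    have h4 : (8 : ℝ) ^ m = 4 ^ m * 2 ^ m := by rw [← mul_pow]; norm_num
    have h5 := mul_le_mul_of_nonneg_left (h2.trans (add_le_add h3 le_rfl))
      (show (0 : ℝ) ≤ 4 ^ m by positivity)
    rw [h4]
    linarith

variable {f}

theorem abs_comp_le_two_pow (hf : ∀ x, |f x| ≤ 1) (V R : Finset (Fin d)) (x : X.faces) :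
    |comp f V R x| ≤ 2 ^ d := (abs_comp_le V R hf x).trans (two_pow_card_le R)

theorem nrm_comp_le_two_pow (f : X.faces → ℝ) (V R : Finset (Fin d)) :
    X.nrm (comp f V R) ≤ 2 ^ d * X.nrm f :=
  (nrm_comp_le f V R).trans (mul_le_mul_of_nonneg_right (two_pow_card_le R) (nrm_nonneg f))

theorem nrm_comp_mul_comp_le (hf : ∀ x, |f x| ≤ 1) (V R V' R' : Finset (Fin d)) :
    X.nrm (comp f V R * comp f V' R') ≤ 4 ^ d * X.nrm f := by
  refine (nrm_mul_le (abs_comp_le_two_pow hf V R) _).trans ?_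
  refine (mul_le_mul_of_nonneg_left (nrm_comp_le_two_pow f V' R') (by positivity)).trans_eq ?_
  rw [← mul_assoc, ← mul_pow]
  norm_num

theorem sum_le_two_pow_mul (s : Finset (Finset (Fin d))) (F : Finset (Fin d) → ℝ) {B : ℝ}
    (hB : 0 ≤ B) (hF : ∀ S ∈ s, F S ≤ B) : ∑ S ∈ s, F S ≤ 2 ^ d * B := by
  refine (Finset.sum_le_card_nsmul s F B hF).trans ?_
  rw [nsmul_eq_mul]
  refine mul_le_mul_of_nonneg_right ?_ hB
  exact_mod_cast (Finset.card_le_univ s).trans_eq (by simp)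

theorem two_pow_mul_pow (a : ℝ) : 2 ^ d * a ^ d = (2 * a) ^ d := (mul_pow _ _ _).symm

theorem nrm_linkEnergy_le (hf : ∀ x, |f x| ≤ 1) (m : ℕ) (W : Finset (Fin d)) :
    X.nrm (linkEnergy f m W) ≤ 16 ^ d * X.nrm f := by
  have h0 := nrm_nonneg f
  refine (nrm_sum_le _ _).trans ((sum_le_two_pow_mul _ _ (B := 8 ^ d * X.nrm f)
    (by positivity) fun S _ => ?_).trans_eq ?_)
  · rw [nrm_smul, abs_of_nonneg (by positivity)]
    refine (mul_le_mul (two_pow_card_le S) ((nrm_cexp_le _ _).trans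
      (nrm_comp_mul_comp_le hf _ _ _ _)) (nrm_nonneg _) (by positivity)).trans_eq ?_
    rw [← mul_assoc, two_pow_mul_pow]
    norm_num
  · rw [← mul_assoc, two_pow_mul_pow]
    norm_num

theorem abs_linkEnergy_le (hf : ∀ x, |f x| ≤ 1) (m : ℕ) (W : Finset (Fin d)) (x : X.faces) :
    |linkEnergy f m W x| ≤ 16 ^ d := by
  rw [abs_of_nonneg (linkEnergy_nonneg f m W x), linkEnergy, Finset.sum_apply]
  refine (sum_le_two_pow_mul _ _ (B := 8 ^ d) (by positivity) fun S _ => ?_).trans_eq ?_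
  · have h1 : |X.cexp W (comp f ∅ S * comp f ∅ S) x| ≤ 4 ^ d := by
      refine abs_cexp_le_of_bound (fun y => ?_) x
      rw [Pi.mul_apply, abs_mul, show (4 : ℝ) = 2 * 2 by norm_num, mul_pow]
      have := abs_comp_le_two_pow hf ∅ S y
      gcongr
    rw [Pi.smul_apply, smul_eq_mul]
    refine (mul_le_mul (two_pow_card_le S) ((le_abs_self _).trans h1)
      (cexp_mul_self_nonneg _ _ x) (by positivity)).trans_eq ?_
    rw [two_pow_mul_pow]; norm_num
  · rw [two_pow_mul_pow]; norm_num

/-- The Parseval error is small in `L¹` with a factor `‖f‖²` already, so the supremum of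
`linkEnergy` suffices. The other error is small in `L²` with only one factor `‖f‖`; the norm of
`linkEnergy` supplies the second. -/
theorem AlmostCommute.avg_linkEnergy_mul_energyError_le (hX : X.AlmostCommute η) (hη : 0 ≤ η)
    (hf : ∀ x, |f x| ≤ 1) (m : ℕ) {V W : Finset (Fin d)} (hVW : V ⊆ W) :
    X.avg (linkEnergy f m W * energyError f V W) ≤ 2 * 256 ^ d * η * X.nrm f ^ 2 := by
  have h0 := nrm_nonneg f
  have h1 : X.avg (linkEnergy f m W * |X.cexp V (f * f) -
      ∑ R ∈ Vᶜ.powerset, X.cexp V (comp f V R * comp f V R)|) ≤ 256 ^ d * η * X.nrm f ^ 2 := by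
    have h2 := hX.avg_abs_energy_le f V hη
    set k := |X.cexp V (f * f) - ∑ R ∈ Vᶜ.powerset, X.cexp V (comp f V R * comp f V R)|
    have h3 : X.avg (linkEnergy f m W * k) ≤ X.avg ((16 : ℝ) ^ d • k) :=
      avg_mono fun x => mul_le_mul_of_nonneg_right
        ((le_abs_self _).trans (abs_linkEnergy_le hf m W x)) (abs_nonneg _)
    rw [map_smul, smul_eq_mul] at h3
    refine h3.trans ((mul_le_mul_of_nonneg_left h2 (by positivity)).trans_eq ?_)
    rw [show (256 : ℝ) = 16 * 16 by norm_num, mul_pow]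
    ring
  have h2 : ∑ R ∈ Wᶜ.powerset, X.avg (linkEnergy f m W *
      |X.cexp W (comp f V R * comp f V R) - X.cexp V (comp f V R * comp f V R)|) ≤
      2 ^ d * (64 ^ d * η * X.nrm f ^ 2) := by
    refine sum_le_two_pow_mul _ _ (by positivity) fun R hR => ?_
    have hd : W ∩ (V ∪ R) = V := by
      have hR : R ⊆ Wᶜ := Finset.mem_powerset.1 hR
      have h3 : W ∩ R = ∅ := by
        ext i
        simpa using fun h1 h2 => Finset.mem_compl.1 (hR h2) h1
      rw [Finset.inter_union_distrib_left, h3, Finset.union_empty, Finset.inter_eq_right.2 hVW]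
    have h3 := hX W (V ∪ R) (comp f V R * comp f V R)
    rw [hd, cexp_of_isJunta ((isJunta_comp f V R).mul (isJunta_comp f V R))] at h3
    have h4 := (le_abs_self _).trans (abs_avg_mul_le (linkEnergy f m W)
      |X.cexp W (comp f V R * comp f V R) - X.cexp V (comp f V R * comp f V R)|)
    rw [nrm_abs] at h4
    refine h4.trans ((mul_le_mul (nrm_linkEnergy_le hf m W) (h3.trans
      (mul_le_mul_of_nonneg_left (nrm_comp_mul_comp_le hf _ _ _ _) hη)) (nrm_nonneg _)
      (by positivity)).trans_eq ?_)
    rw [show (64 : ℝ) = 16 * 4 by norm_num, mul_pow]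
    ring
  rw [energyError, mul_add, map_add, Finset.mul_sum, map_sum]
  refine (add_le_add h1 h2).trans ?_
  have h3 : (2 : ℝ) ^ d * 64 ^ d ≤ 256 ^ d := by
    rw [← mul_pow]
    exact pow_le_pow_left₀ (by norm_num) (by norm_num) d
  have h4 := mul_le_mul_of_nonneg_right h3 (show 0 ≤ η * X.nrm f ^ 2 by positivity)
  linarith

/-- The pointwise bound from globalness is multiplied by `linkEnergy` before averaging, because its
error terms are not small pointwise. -/
theorem AlmostCommute.avg_linkEnergy_sq_le (hX : X.AlmostCommute η) (hη : 0 ≤ η)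
    (hf : ∀ x, |f x| ≤ 1) {m : ℕ} (hm : m ≤ d) {δ : ℝ} (hδ : 0 ≤ δ)
    (hglob : ∀ V : Finset (Fin d), V.card ≤ m → ∀ x, X.cexp V (f * f) x ≤ δ)
    (W : Finset (Fin d)) :
    X.avg (linkEnergy f m W * linkEnergy f m W) ≤
      8 ^ m * δ * X.avg (linkEnergy f m W) + 2 * 2048 ^ d * η * X.nrm f ^ 2 := by
  have h0 := nrm_nonneg f
  have h1 : linkEnergy f m W * linkEnergy f m W ≤ (8 ^ m * δ) • linkEnergy f m W +
      (4 : ℝ) ^ m • ∑ V ∈ W.powerset, linkEnergy f m W * energyError f V W := by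
    intro x
    have h2 := mul_le_mul_of_nonneg_left (linkEnergy_le_of_global f hδ hglob W x)
      (linkEnergy_nonneg f m W x)
    simp only [Pi.mul_apply, Pi.add_apply, Pi.smul_apply, Finset.sum_apply, smul_eq_mul,
      ← Finset.mul_sum]
    linarith
  have h2 := avg_mono h1
  rw [map_add, map_smul, map_smul, map_sum, smul_eq_mul, smul_eq_mul] at h2
  have h3 : ∑ V ∈ W.powerset, X.avg (linkEnergy f m W * energyError f V W) ≤
      2 ^ d * (2 * 256 ^ d * η * X.nrm f ^ 2) :=
    sum_le_two_pow_mul _ _ (by positivity) fun V hV =>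
      hX.avg_linkEnergy_mul_energyError_le hη hf m (Finset.mem_powerset.1 hV)
  have h4 : (4 : ℝ) ^ m ≤ 4 ^ d := pow_le_pow_right₀ (by norm_num) hm
  refine h2.trans (add_le_add le_rfl ?_)
  calc _ ≤ (4 : ℝ) ^ m * (2 ^ d * (2 * 256 ^ d * η * X.nrm f ^ 2)) :=
        mul_le_mul_of_nonneg_left h3 (by positivity)
    _ ≤ (4 : ℝ) ^ d * (2 ^ d * (2 * 256 ^ d * η * X.nrm f ^ 2)) :=
        mul_le_mul_of_nonneg_right h4 (by positivity)
    _ = _ := by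
        rw [show (2048 : ℝ) = 4 * 2 * 256 by norm_num, mul_pow, mul_pow]
        ring

/-- Each `S` is counted by its `2 ^ |S|` subsets `W` with weight `2 ^ |S|`; Parseval does the rest.
-/
theorem AlmostCommute.sum_avg_linkEnergy_le (hX : X.AlmostCommute η) (hη : 0 ≤ η)
    (hη' : 16 ^ d * η ≤ 1) (m : ℕ) :
    ∑ W, X.avg (linkEnergy f m W) ≤ 2 * 4 ^ m * X.nrm f ^ 2 := by
  have h0 := sq_nonneg (X.nrm f)
  have h1 : ∑ W, X.avg (linkEnergy f m W) = ∑ S : Finset (Fin d) with S.card ≤ m,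
      (4 : ℝ) ^ S.card * X.avg (comp f ∅ S * comp f ∅ S) := by
    simp only [linkEnergy, map_sum, map_smul, avg_cexp, smul_eq_mul]
    simp only [Finset.sum_filter]
    rw [Finset.sum_comm]
    refine Finset.sum_congr rfl fun S _ => ?_
    by_cases hS : S.card ≤ m
    · simp only [hS, and_true, if_true]
      rw [← Finset.sum_filter, Finset.filter_subset_univ, Finset.sum_const, Finset.card_powerset,
        nsmul_eq_mul, show (4 : ℝ) = 2 * 2 by norm_num, mul_pow]
      push_cast
      ring
    · simp [hS]
  have h2 : ∑ S : Finset (Fin d), X.avg (comp f ∅ S * comp f ∅ S) ≤ 2 * X.nrm f ^ 2 := by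
    have h3 := (abs_avg_le _).trans (hX.avg_abs_energy_le f ∅ hη)
    rw [map_sub, map_sum, avg_cexp, ← nrm_sq, Finset.compl_empty, Finset.powerset_univ] at h3
    simp only [avg_cexp] at h3
    have h4 := mul_le_mul_of_nonneg_right hη' h0
    linarith [(abs_le.1 h3).1]
  rw [h1]
  calc _ ≤ ∑ S : Finset (Fin d) with S.card ≤ m,
        (4 : ℝ) ^ m * X.avg (comp f ∅ S * comp f ∅ S) := by
        refine Finset.sum_le_sum fun S hS => mul_le_mul_of_nonneg_right ?_ (avg_mul_self_nonneg _)
        exact pow_le_pow_right₀ (by norm_num) (Finset.mem_filter.1 hS).2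
    _ ≤ ∑ S : Finset (Fin d), (4 : ℝ) ^ m * X.avg (comp f ∅ S * comp f ∅ S) :=
        Finset.sum_le_sum_of_subset_of_nonneg (Finset.filter_subset _ _) fun S _ _ =>
          mul_nonneg (by positivity) (avg_mul_self_nonneg _)
    _ ≤ _ := by
        rw [← Finset.mul_sum]
        linarith [mul_le_mul_of_nonneg_left h2 (show (0 : ℝ) ≤ 4 ^ m by positivity)]

theorem AlmostCommute.sum_avg_sqrt_linkEnergy_le (hX : X.AlmostCommute η) (hη : 0 ≤ η)
    (hη' : 16 ^ d * η ≤ 1) (hf : ∀ x, |f x| ≤ 1) {m : ℕ} (hm : m ≤ d) {δ τ : ℝ} (hδ : 0 ≤ δ)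
    (hτ : 0 < τ)
    (hglob : ∀ V : Finset (Fin d), V.card ≤ m → ∀ x, X.cexp V (f * f) x ≤ δ) :
    ∑ W, X.avg (fun x => √(linkEnergy f m W x) ^ 3) ≤
      (4 ^ m * τ + 32 ^ m * δ / τ + 4096 ^ d * η / τ) * X.nrm f ^ 2 := by
  have h0 := sq_nonneg (X.nrm f)
  have h1 : ∀ W, X.avg (fun x => √(linkEnergy f m W x) ^ 3) ≤
      (τ / 2 + 8 ^ m * δ / (2 * τ)) * X.avg (linkEnergy f m W) +
        2048 ^ d * η / τ * X.nrm f ^ 2 := by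
    intro W
    -- Arithmetic–geometric mean: `s³ ≤ τ s² / 2 + s⁴ / (2τ)`, with `τ` left free to balance the two
    -- terms.
    have h2 : (fun x => √(linkEnergy f m W x) ^ 3) ≤ (τ / 2) • linkEnergy f m W +
        (1 / (2 * τ)) • (linkEnergy f m W * linkEnergy f m W) := by
      intro x
      simp only [Pi.add_apply, Pi.smul_apply, Pi.mul_apply, smul_eq_mul]
      set s := √(linkEnergy f m W x) with hs
      have h3 : linkEnergy f m W x = s ^ 2 := (Real.sq_sqrt (linkEnergy_nonneg f m W x)).symm
      rw [h3]
      have h4 : τ / 2 * s ^ 2 + 1 / (2 * τ) * (s ^ 2 * s ^ 2) - s ^ 3 =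
          s ^ 2 * (s - τ) ^ 2 / (2 * τ) := by field_simp; ring
      have h5 : 0 ≤ s ^ 2 * (s - τ) ^ 2 / (2 * τ) := by positivity
      linarith
    have h3 := avg_mono h2
    rw [map_add, map_smul, map_smul, smul_eq_mul, smul_eq_mul] at h3
    have h4 := mul_le_mul_of_nonneg_left (hX.avg_linkEnergy_sq_le hη hf hm hδ hglob W)
      (show 0 ≤ 1 / (2 * τ) by positivity)
    refine h3.trans ((add_le_add le_rfl h4).trans_eq ?_)
    field_simp
    ring
  refine (Finset.sum_le_sum fun W _ => h1 W).trans ?_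
  rw [Finset.sum_add_distrib, ← Finset.mul_sum]
  have h2 := mul_le_mul_of_nonneg_left (hX.sum_avg_linkEnergy_le (f := f) hη hη' m)
    (show 0 ≤ τ / 2 + 8 ^ m * δ / (2 * τ) by positivity)
  refine (add_le_add h2 le_rfl).trans_eq ?_
  simp only [Finset.sum_const, nsmul_eq_mul, Finset.card_univ, Fintype.card_finset,
    Fintype.card_fin]
  rw [show (4096 : ℝ) = 2 * 2048 by norm_num, mul_pow 2, show (32 : ℝ) = 4 * 8 by norm_num, mul_pow]
  push_cast
  field_simp

end PartiteComplex

/-! ### The low-degree part tested against `f` -/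

namespace PartiteComplex

variable {d : ℕ} {Ω : Fin d → Type*} [∀ i, Fintype (Ω i)] {X : PartiteComplex Ω} {η : ℝ}
  {f : X.faces → ℝ}

/-- Conditioning on all coordinates except `i` pulls out the two components without `i` and nearly
kills the third. -/
theorem AlmostCommute.abs_avg_comp_mul_le (hX : X.AlmostCommute η) (hη : 0 ≤ η)
    (hf : ∀ x, |f x| ≤ 1) {i : Fin d} {U S T : Finset (Fin d)} (hU : i ∈ U) (hS : i ∉ S)
    (hT : i ∉ T) :
    |X.avg (comp f ∅ U * (comp f ∅ S * comp f ∅ T))| ≤ 8 ^ d * η * X.nrm f ^ 2 := by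
  have hsub : ∀ {Q : Finset (Fin d)}, i ∉ Q → X.IsJunta (Finset.univ.erase i) (comp f ∅ Q) :=
    fun {Q} hQ => (isJunta_comp f ∅ Q).mono fun j hj => by
      rw [Finset.empty_union] at hj
      exact Finset.mem_erase.2 ⟨fun h => hQ (h ▸ hj), Finset.mem_univ j⟩
  rw [mul_comm, ← avg_cexp (Finset.univ.erase i), cexp_mul_of_isJunta ((hsub hS).mul (hsub hT))]
  refine (abs_avg_mul_le _ _).trans ?_
  have h0 := nrm_nonneg f
  refine (mul_le_mul (nrm_comp_mul_comp_le hf _ _ _ _) (hX.nrm_cexp_erase_comp f hη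
    (Finset.notMem_empty i) hU) (nrm_nonneg _) (by positivity)).trans_eq ?_
  rw [show (8 : ℝ) = 4 * 2 by norm_num, mul_pow]
  ring

theorem AlmostCommute.abs_avg_comp_le_of_not_coverTwice (hX : X.AlmostCommute η) (hη : 0 ≤ η)
    (hf : ∀ x, |f x| ≤ 1) {x : Finset (Fin d) × Finset (Fin d) × Finset (Fin d)}
    (hx : ¬ CoverTwice x) :
    |X.avg (comp f ∅ x.1 * (comp f ∅ x.2.1 * comp f ∅ x.2.2))| ≤ 8 ^ d * η * X.nrm f ^ 2 := by
  obtain ⟨U, S, T⟩ := x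
  simp only [CoverTwice, not_and_or, Finset.not_subset, Finset.mem_union, not_or] at hx
  rcases hx with ⟨i, h1, h2, h3⟩ | ⟨i, h1, h2, h3⟩ | ⟨i, h1, h2, h3⟩
  · exact hX.abs_avg_comp_mul_le hη hf h1 h2 h3
  · rw [mul_left_comm]
    exact hX.abs_avg_comp_mul_le hη hf h1 h2 h3
  · rw [← mul_assoc, mul_comm]
    exact hX.abs_avg_comp_mul_le hη hf h1 h2 h3

theorem AlmostCommute.abs_avg_comp_le (hX : X.AlmostCommute η) (hη : 0 ≤ η)
    (hf : ∀ x, |f x| ≤ 1) (U S T : Finset (Fin d)) :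
    |X.avg (comp f ∅ U * (comp f ∅ S * comp f ∅ T))| ≤
      X.avg (fun x => √(X.cexp (U ∩ S ∩ (U ∩ T)) (comp f ∅ U * comp f ∅ U) x) *
        (√(X.cexp (U ∩ S ∩ (U ∩ T)) (comp f ∅ S * comp f ∅ S) x) *
          √(X.cexp (U ∩ S ∩ (U ∩ T)) (comp f ∅ T * comp f ∅ T) x))) +
        3 * 8 ^ d * √η * X.nrm f ^ 2 := by
  have hj : ∀ Q, X.IsJunta Q (comp f ∅ Q) := fun Q => by
    simpa using isJunta_comp f ∅ Q
  have h0 := nrm_nonneg f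
  refine (hX.abs_avg_mul_mul_le hη (hj U) (hj S) (hj T) (abs_comp_le_two_pow hf ∅ S)
    (abs_comp_le_two_pow hf ∅ T)).trans (add_le_add le_rfl ?_)
  have h1 : ∀ Q, (2 : ℝ) ^ d * X.nrm (comp f ∅ Q) ≤ 4 ^ d * X.nrm f := fun Q => by
    refine (mul_le_mul_of_nonneg_left (nrm_comp_le_two_pow f ∅ Q) (by positivity)).trans_eq ?_
    rw [← mul_assoc, two_pow_mul_pow]
    norm_num
  have h2 : √(η * (2 ^ d * X.nrm (comp f ∅ S)) * (2 ^ d * X.nrm (comp f ∅ T))) ≤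
      √η * (4 ^ d * X.nrm f) := by
    refine Real.sqrt_le_iff.2 ⟨by positivity, ?_⟩
    rw [mul_pow, Real.sq_sqrt hη, mul_assoc, pow_two (4 ^ d * _)]
    refine mul_le_mul_of_nonneg_left ?_ hη
    exact mul_le_mul (h1 S) (h1 T) (mul_nonneg (by positivity) (nrm_nonneg _)) (by positivity)
  have h3 : 3 * X.nrm (comp f ∅ U) ≤ 3 * (2 ^ d * X.nrm f) :=
    mul_le_mul_of_nonneg_left (nrm_comp_le_two_pow f ∅ U) (by norm_num)
  refine (mul_le_mul h3 h2 (Real.sqrt_nonneg _) (by positivity)).trans_eq ?_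
  rw [show (8 : ℝ) = 2 * 4 by norm_num, mul_pow]
  ring

/-- The part of degree at most `r` of `f`. -/
noncomputable def lowDegree (f : X.faces → ℝ) (r : ℕ) : X.faces → ℝ :=
  ∑ S : Finset (Fin d) with S.card ≤ r, comp f ∅ S

/-- Group the triples by their common part `W` and apply `sum_coverTwice_le` at each face. Covering
forces `U ⊆ S ∪ T`, hence the degree bound `2 * r`. -/
theorem sum_coverTwice_le_linkEnergy (f : X.faces → ℝ) (r : ℕ) :
    ∑ x : Finset (Fin d) × Finset (Fin d) × Finset (Fin d) with
      (x.2.1.card ≤ r ∧ x.2.2.card ≤ r) ∧ CoverTwice x,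
        X.avg (fun y => √(X.cexp (x.1 ∩ x.2.1 ∩ (x.1 ∩ x.2.2)) (comp f ∅ x.1 * comp f ∅ x.1) y) *
        (√(X.cexp (x.1 ∩ x.2.1 ∩ (x.1 ∩ x.2.2)) (comp f ∅ x.2.1 * comp f ∅ x.2.1) y) *
          √(X.cexp (x.1 ∩ x.2.1 ∩ (x.1 ∩ x.2.2)) (comp f ∅ x.2.2 * comp f ∅ x.2.2) y))) ≤
      ∑ W, X.avg (fun y => √(linkEnergy f (2 * r) W y) ^ 3) := by
  set N : Finset (Fin d) → X.faces → Finset (Fin d) → ℝ := fun W y S =>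
    if S.card ≤ 2 * r then √(X.cexp W (comp f ∅ S * comp f ∅ S) y) else 0 with hN
  have hN0 : ∀ W y S, 0 ≤ N W y S := fun W y S => by
    simp only [hN]; split_ifs
    exacts [Real.sqrt_nonneg _, le_rfl]
  have h1 : ∀ W y, ∑ x : Finset (Fin d) × Finset (Fin d) × Finset (Fin d) with
      CoverTwice x ∧ x.1 ∩ x.2.1 ∩ (x.1 ∩ x.2.2) = W,
        N W y x.1 * (N W y x.2.1 * N W y x.2.2) ≤ √(linkEnergy f (2 * r) W y) ^ 3 := by
    intro W y
    refine (sum_coverTwice_le W (N W y) (hN0 W y)).trans_eq ?_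
    congr 2
    rw [linkEnergy, Finset.sum_apply, Finset.sum_filter, Finset.sum_filter]
    refine Finset.sum_congr rfl fun S _ => ?_
    by_cases hS : S.card ≤ 2 * r
    · simp [hN, hS, Real.sq_sqrt (cexp_mul_self_nonneg W (comp f ∅ S) y)]
    · simp [hN, hS]
  have h2 := Finset.sum_le_sum fun W (_ : W ∈ Finset.univ) => avg_mono (fun y => h1 W y)
  refine le_trans ?_ h2
  have h3 : ∀ W, X.avg (fun y => ∑ x : Finset (Fin d) × Finset (Fin d) × Finset (Fin d) with
      CoverTwice x ∧ x.1 ∩ x.2.1 ∩ (x.1 ∩ x.2.2) = W,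
        N W y x.1 * (N W y x.2.1 * N W y x.2.2)) =
      ∑ x : Finset (Fin d) × Finset (Fin d) × Finset (Fin d) with CoverTwice x,
        if x.1 ∩ x.2.1 ∩ (x.1 ∩ x.2.2) = W then
          X.avg (fun y => N W y x.1 * (N W y x.2.1 * N W y x.2.2)) else 0 := by
    intro W
    rw [← Finset.sum_filter, Finset.filter_filter, ← map_sum]
    congr 1
    ext y
    rw [Finset.sum_apply]
  simp only [h3]
  rw [Finset.sum_comm]
  simp only [Finset.sum_ite_eq, Finset.mem_univ, if_true]
  rw [← Finset.filter_filter]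
  rw [Finset.filter_comm]
  refine (Finset.sum_le_sum fun x hx => ?_).trans
    (Finset.sum_le_sum_of_subset_of_nonneg (Finset.filter_subset _ _) fun x _ _ =>
      avg_nonneg fun y => mul_nonneg (hN0 _ _ _) (mul_nonneg (hN0 _ _ _) (hN0 _ _ _)))
  obtain ⟨hx1, hS, hT⟩ := Finset.mem_filter.1 hx
  have hc := (Finset.mem_filter.1 hx1).2
  have hU : x.1.card ≤ 2 * r := by
    have := (Finset.card_le_card hc.1).trans (Finset.card_union_le _ _)
    omega
  refine le_of_eq ?_
  simp only [hN, hU, show x.2.1.card ≤ 2 * r by omega, show x.2.2.card ≤ 2 * r by omega, if_true]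

/-- All three factors are expanded into components. Covering triples are controlled by link
energies; there are at most `8 ^ d` triples in all, each with an error of order `√η`. -/
theorem AlmostCommute.avg_mul_lowDegree_sq_le (hX : X.AlmostCommute η) (hη : 0 ≤ η)
    (hη' : 16 ^ d * η ≤ 1) (hf : ∀ x, |f x| ≤ 1) {r : ℕ} (hr : 2 * r ≤ d) {δ τ : ℝ}
    (hδ : 0 ≤ δ) (hτ : 0 < τ)
    (hglob : ∀ V : Finset (Fin d), V.card ≤ 2 * r → ∀ x, X.cexp V (f * f) x ≤ δ) :
    X.avg (f * (lowDegree f r * lowDegree f r)) ≤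
      (4 ^ (2 * r) * τ + 32 ^ (2 * r) * δ / τ + 4096 ^ d * η / τ + 4 * 64 ^ d * √η) *
        X.nrm f ^ 2 := by
  have h0 := sq_nonneg (X.nrm f)
  set F : Finset (Fin d) × Finset (Fin d) × Finset (Fin d) → ℝ := fun x =>
    X.avg (comp f ∅ x.1 * (comp f ∅ x.2.1 * comp f ∅ x.2.2)) with hF
  have h1 : X.avg (f * (lowDegree f r * lowDegree f r)) =
      ∑ x : Finset (Fin d) × Finset (Fin d) × Finset (Fin d) with
        x.2.1.card ≤ r ∧ x.2.2.card ≤ r, F x := by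
    have h2 : (Finset.univ.filter fun x : Finset (Fin d) × Finset (Fin d) × Finset (Fin d) =>
        x.2.1.card ≤ r ∧ x.2.2.card ≤ r) = Finset.univ ×ˢ
          ((Finset.univ.filter fun S : Finset (Fin d) => S.card ≤ r) ×ˢ
            (Finset.univ.filter fun S : Finset (Fin d) => S.card ≤ r)) := by
      ext x; simp
    rw [h2, Finset.sum_product]
    simp only [Finset.sum_product, hF]
    conv_lhs => rw [← sum_comp f]
    simp only [← map_sum, ← Finset.mul_sum, ← Finset.sum_mul, sum_comp, lowDegree]
  have h2 : ∀ x ∈ Finset.univ.filter fun x : Finset (Fin d) × Finset (Fin d) × Finset (Fin d) =>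
      x.2.1.card ≤ r ∧ x.2.2.card ≤ r, F x ≤
      (if CoverTwice x then
        X.avg (fun y => √(X.cexp (x.1 ∩ x.2.1 ∩ (x.1 ∩ x.2.2)) (comp f ∅ x.1 * comp f ∅ x.1) y) *
        (√(X.cexp (x.1 ∩ x.2.1 ∩ (x.1 ∩ x.2.2)) (comp f ∅ x.2.1 * comp f ∅ x.2.1) y) *
          √(X.cexp (x.1 ∩ x.2.1 ∩ (x.1 ∩ x.2.2)) (comp f ∅ x.2.2 * comp f ∅ x.2.2) y))) else 0)
        + 4 * 8 ^ d * √η * X.nrm f ^ 2 := by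
    intro x _
    have hη1 : η ≤ 1 := le_trans (le_mul_of_one_le_left hη (one_le_pow₀ (by norm_num))) hη'
    have h3 : η ≤ √η := Real.le_sqrt_of_sq_le (by nlinarith)
    have h4 : 0 ≤ 8 ^ d * X.nrm f ^ 2 := by positivity
    have h5 := mul_le_mul_of_nonneg_right h3 h4
    have h6 := mul_nonneg (Real.sqrt_nonneg η) h4
    refine (le_abs_self _).trans ?_
    split_ifs with hc
    · have := hX.abs_avg_comp_le hη hf x.1 x.2.1 x.2.2
      linarith
    · have := hX.abs_avg_comp_le_of_not_coverTwice hη hf hc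
      linarith
  rw [h1]
  refine (Finset.sum_le_sum h2).trans ?_
  rw [Finset.sum_add_distrib, ← Finset.sum_filter, Finset.filter_filter]
  have h3 := (sum_coverTwice_le_linkEnergy f r).trans
    (hX.sum_avg_sqrt_linkEnergy_le hη hη' hf hr hδ hτ hglob)
  have h4 : ∑ x : Finset (Fin d) × Finset (Fin d) × Finset (Fin d) with
      x.2.1.card ≤ r ∧ x.2.2.card ≤ r, 4 * 8 ^ d * √η * X.nrm f ^ 2 ≤
        8 ^ d * (4 * 8 ^ d * √η * X.nrm f ^ 2) := by
    rw [Finset.sum_const, nsmul_eq_mul]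
    refine mul_le_mul_of_nonneg_right ?_ (by positivity)
    have h5 := Finset.card_le_univ
      (Finset.univ.filter fun x : Finset (Fin d) × Finset (Fin d) × Finset (Fin d) =>
        x.2.1.card ≤ r ∧ x.2.2.card ≤ r)
    simp only [Fintype.card_prod, Fintype.card_finset, Fintype.card_fin] at h5
    rw [← mul_pow, ← mul_pow] at h5
    exact_mod_cast h5
  refine (add_le_add h3 h4).trans_eq ?_
  rw [show (64 : ℝ) = 8 * 8 by norm_num, mul_pow]
  ring

/-- Cauchy–Schwarz with `f` kept in both factors, which is possible because `f = f²`. -/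
theorem lowDegree_avg_sq_le (hff : f * f = f) (r : ℕ) :
    X.avg (f * lowDegree f r) ^ 2 ≤
      X.nrm f ^ 2 * X.avg (f * (lowDegree f r * lowDegree f r)) := by
  have h1 := avg_mul_sq_le f (f * lowDegree f r)
  have h2 : f * (f * lowDegree f r) = f * lowDegree f r := by rw [← mul_assoc, hff]
  have h3 : f * lowDegree f r * (f * lowDegree f r) = f * (lowDegree f r * lowDegree f r) := by
    rw [mul_mul_mul_comm, hff]
  rwa [h2, h3, ← nrm_sq] at h1

theorem avg_mul_lowDegree (r : ℕ) :
    X.avg (f * lowDegree f r) = X.nrm f ^ 2 -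
      ∑ S : Finset (Fin d) with r < S.card, X.avg (f * comp f ∅ S) := by
  rw [nrm_sq, lowDegree, eq_sub_iff_add_eq, ← map_sum, ← Finset.mul_sum, ← map_add, ← mul_add]
  simp only [← not_le]
  rw [Finset.sum_filter_add_sum_filter_not, sum_comp]

/-- If `f` has small influence then it has large density on some link of bounded codimension. -/
theorem AlmostCommute.exists_lt_cexp (hX : X.AlmostCommute η) (hη : 0 ≤ η)
    (hηd : η ≤ (1 / 2) ^ (38 * d)) (hd : 1 ≤ d) (hff : f * f = f) (hf0 : 0 < X.nrm f) {K : ℝ}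
    (hI : X.infl f ≤ K * X.nrm f ^ 2) {r : ℕ} (hr : 1 ≤ r) (hrd : 2 * r ≤ d)
    (hrK : 4 * K ≤ r) :
    ∃ V : Finset (Fin d), V.card ≤ 2 * r ∧ ∃ x, (1 / 2) ^ (26 * r) < X.cexp V f x := by
  by_contra! hglob
  have hf : ∀ x, |f x| ≤ 1 := fun x => by
    have h1 : f x * f x = f x := congrFun hff x
    rcases mul_eq_zero.1 (show f x * (f x - 1) = 0 by linarith) with h2 | h2
    · simp [h2]
    · simp [sub_eq_zero.1 h2]
  have hpow : ∀ {a b : ℕ}, a ≤ b → ((1 : ℝ) / 2) ^ b ≤ (1 / 2) ^ a := fun h =>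
    pow_le_pow_of_le_one (by norm_num) (by norm_num) h
  have hcancel : ∀ a b : ℕ, (2 : ℝ) ^ a * (1 / 2) ^ (a + b) = (1 / 2) ^ b := fun a b => by
    rw [pow_add, ← mul_assoc, ← mul_pow]; norm_num
  have hη1 : 16 ^ d * η ≤ 1 := by
    calc (16 : ℝ) ^ d * η ≤ 2 ^ (4 * d) * (1 / 2) ^ (4 * d + 34 * d) := by
          rw [show (16 : ℝ) = 2 ^ 4 by norm_num, ← pow_mul, ← add_mul]
          gcongr
      _ ≤ 1 := by rw [hcancel]; exact pow_le_one₀ (by norm_num) (by norm_num)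
  have hη2 : 32 ^ d * η ≤ 1 / 32 := by
    calc (32 : ℝ) ^ d * η ≤ 2 ^ (5 * d) * (1 / 2) ^ (5 * d + 33 * d) := by
          rw [show (32 : ℝ) = 2 ^ 5 by norm_num, ← pow_mul, ← add_mul]
          gcongr
      _ ≤ 1 / 32 := by
          rw [hcancel]
          exact (hpow (show 5 ≤ 33 * d by omega)).trans_eq (by norm_num)
  have hsq : √η ≤ (1 / 2) ^ (19 * d) := by
    refine Real.sqrt_le_iff.2 ⟨by positivity, hηd.trans_eq ?_⟩
    rw [← pow_mul]; congr 1; ring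
  -- With `m = 2r`, the choices `τ = 2^(-10r)` and `δ = 2^(-26r)` turn both main terms into
  -- `2^(-6r)`, at most `1/64`; the two error terms are given the same share, for a total of `1/16`.
  have e1 : (4 : ℝ) ^ (2 * r) * (1 / 2) ^ (10 * r) ≤ 1 / 64 := by
    calc (4 : ℝ) ^ (2 * r) * (1 / 2) ^ (10 * r) = 2 ^ (4 * r) * (1 / 2) ^ (4 * r + 6 * r) := by
          rw [show (4 : ℝ) = 2 ^ 2 by norm_num, ← pow_mul, ← add_mul, ← mul_assoc]
          norm_num
      _ ≤ 1 / 64 := by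
          rw [hcancel]
          exact (hpow (show 6 ≤ 6 * r by omega)).trans_eq (by norm_num)
  have e2 : (32 : ℝ) ^ (2 * r) * (1 / 2) ^ (26 * r) / (1 / 2) ^ (10 * r) ≤ 1 / 64 := by
    calc (32 : ℝ) ^ (2 * r) * (1 / 2) ^ (26 * r) / (1 / 2) ^ (10 * r) =
        2 ^ (10 * r) * (1 / 2) ^ (10 * r + 6 * r) := by
          rw [show (32 : ℝ) = 2 ^ 5 by norm_num, ← pow_mul, show 26 * r = 10 * r + 6 * r + 10 * r by
            ring, pow_add _ (10 * r + 6 * r), ← mul_assoc, mul_div_assoc, div_self (by positivity)]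
          ring_nf
      _ ≤ 1 / 64 := by
          rw [hcancel]
          exact (hpow (show 6 ≤ 6 * r by omega)).trans_eq (by norm_num)
  have e3 : (4096 : ℝ) ^ d * η / (1 / 2) ^ (10 * r) ≤ 1 / 64 := by
    rw [div_le_iff₀ (by positivity)]
    calc (4096 : ℝ) ^ d * η ≤ 2 ^ (12 * d) * (1 / 2) ^ (12 * d + 26 * d) := by
          rw [show (4096 : ℝ) = 2 ^ 12 by norm_num, ← pow_mul, ← add_mul]
          gcongr
      _ ≤ 1 / 64 * (1 / 2) ^ (10 * r) := by
          rw [hcancel]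
          refine (hpow (show 6 + 10 * r ≤ 26 * d by omega)).trans_eq ?_
          rw [pow_add]; norm_num
  have e4 : 4 * (64 : ℝ) ^ d * √η ≤ 1 / 64 := by
    calc 4 * (64 : ℝ) ^ d * √η ≤ 4 * (2 ^ (6 * d) * (1 / 2) ^ (6 * d + 13 * d)) := by
          rw [show (64 : ℝ) = 2 ^ 6 by norm_num, ← pow_mul, ← add_mul, mul_assoc]
          gcongr
      _ ≤ 1 / 64 := by
          rw [hcancel]
          have := (hpow (show 8 ≤ 13 * d by omega))
          norm_num at this ⊢
          linarith
  have hup := hX.avg_mul_lowDegree_sq_le hη hη1 hf hrd (δ := (1 / 2) ^ (26 * r))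
    (τ := (1 / 2) ^ (10 * r)) (by positivity) (by positivity) (by rwa [hff])
  have hlow := lowDegree_avg_sq_le hff r
  have htail := hX.mul_sum_filter_le f hη r
  have hdef := avg_mul_lowDegree (f := f) r
  set t := ∑ S : Finset (Fin d) with r < S.card, X.avg (f * comp f ∅ S)
  set μ := X.nrm f ^ 2 with hμ
  have hμ0 : 0 < μ := by positivity
  have h1 : X.avg (f * (lowDegree f r * lowDegree f r)) ≤ 1 / 16 * μ :=
    hup.trans (mul_le_mul_of_nonneg_right (by linarith) hμ0.le)
  have h2 : X.avg (f * lowDegree f r) ^ 2 ≤ (1 / 4 * μ) ^ 2 := by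
    have := mul_le_mul_of_nonneg_left h1 hμ0.le
    nlinarith
  have h3 := (abs_le_of_sq_le_sq' h2 (by positivity)).2
  have h4 : (r + 1) * t ≤ (K + 1 / 16) * μ := by
    have := mul_le_mul_of_nonneg_right hη2 hμ0.le
    nlinarith
  have h5 : t ≤ 1 / 4 * μ := by
    -- Since `4K ≤ r`, one has `K + 1/16 ≤ (r + 1) / 4`. The tail is thus at most `μ/4`, so `𝔼[f g]
    -- ≥ 3μ/4`, against the upper bound `μ/4` of `h3`.
    have hr0 : (0 : ℝ) < r + 1 := by positivity
    refine le_of_mul_le_mul_left (h4.trans ?_) hr0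
    nlinarith
  linarith

end PartiteComplex

/-! ### Translation to the statement and choice of constants -/

namespace PartiteComplex

variable {d : ℕ} {Ω : Fin d → Type*} [∀ i, Fintype (Ω i)] {X : PartiteComplex Ω} {η : ℝ}

theorem restrict_mem_projFaces (S : Finset (Fin d)) (x : X.faces) :
    S.restrict x.1 ∈ X.projFaces S := ⟨x.1, x.2, rfl⟩

theorem IsGammaProduct.mono {γ γ' : ℝ} (hX : X.IsGammaProduct γ) (h : γ ≤ γ') :
    X.IsGammaProduct γ' := fun S z hz i j hi hj hij g =>
  (hX S z hz i j hi hj hij g).trans (mul_le_mul_of_nonneg_right h (Real.sqrt_nonneg _))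

theorem totalInfluence_eq_infl (g : (∀ i, Ω i) → ℝ) :
    X.totalInfluence g = X.infl (fun x => g x.1) := by
  refine Finset.sum_congr rfl fun i _ => ?_
  rw [expect_eq_avg]
  congr 1
  ext x
  simp only [laplacian, proj, condExpect_cylinder, Pi.mul_apply, Pi.sub_apply]

theorem variance_eq_nrm_sq (g : (∀ i, Ω i) → ℝ) :
    X.variance g = X.nrm ((fun x => g x.1) - fun _ => X.avg fun x => g x.1) ^ 2 := by
  rw [variance, expect_eq_avg, expect_eq_avg, nrm_sq]
  congr 1
  ext x
  simp [pow_two]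

/-- The Laplacians kill constants and have mean zero. -/
theorem infl_sub_const (g : X.faces → ℝ) (a : ℝ) : X.infl (g - fun _ => a) = X.infl g := by
  refine Finset.sum_congr rfl fun i _ => ?_
  have h1 : (fun _ => a : X.faces → ℝ) = a • 1 := by ext; simp
  rw [map_sub, cexp_const, sub_sub_sub_cancel_right, sub_mul, map_sub, h1, smul_mul_assoc,
    one_mul, map_smul, map_sub, avg_cexp, sub_self, smul_zero, sub_zero]

/-- An approximate Poincaré inequality. -/
theorem AlmostCommute.nrm_sq_le_infl (hX : X.AlmostCommute η) (hη : 0 ≤ η)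
    (h : X.faces → ℝ) (h0 : X.avg h = 0) :
    X.nrm h ^ 2 ≤ X.infl h + 2 * 32 ^ d * η * X.nrm h ^ 2 := by
  -- At `r = 0` the tail is everything, because the only component of degree zero is the mean, here
  -- `0`.
  have h1 := hX.mul_sum_filter_le h hη 0
  have h2 := avg_mul_lowDegree (f := h) 0
  have h3 : lowDegree h 0 = 0 := by
    have h4 : (Finset.univ.filter fun S : Finset (Fin d) => S.card ≤ 0) = {∅} := by
      ext S; simp
    rw [lowDegree, h4, Finset.sum_singleton, comp_empty, cexp_empty, h0]
    rfl
  rw [h3, mul_zero, map_zero] at h2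
  simp only [Nat.cast_zero, zero_add, one_mul] at h1
  linarith

end PartiteComplex

theorem toReal01_mul_self {α : Type*} (f : α → ZMod 2) (x : α) :
    toReal01 f x * toReal01 f x = toReal01 f x := by
  have : ∀ a : ZMod 2, (a.val : ℝ) * a.val = a.val := by
    intro a
    fin_cases a <;> simp [ZMod.val]
  exact this (f x)

theorem toReal01_eq_one {α : Type*} {f : α → ZMod 2} {x : α} (hx : f x ≠ 0) :
    toReal01 f x = 1 := by
  have : ∀ a : ZMod 2, a ≠ 0 → (a.val : ℝ) = 1 := by
    intro a ha
    fin_cases a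
    · exact absurd rfl ha
    · simp [ZMod.val]
  exact this (f x) hx

open PartiteComplex in
theorem mainTheorem7 :
    ∃ c C : ℝ, 0 < c ∧ 0 < C ∧
      ∀ (d : ℕ) (Ω : Fin d → Type*) [∀ i, Fintype (Ω i)] (X : PartiteComplex Ω) (γ K : ℝ)
        (f : (∀ i, Ω i) → ZMod 2),
        X.IsGammaProduct γ → γ ≤ (2 : ℝ) ^ (-(c * d)) → 0 ≤ K →
        (∃ x ∈ X.faces, f x ≠ 0) →
        X.totalInfluence (toReal01 f) ≤ K * X.variance (toReal01 f) →
        ∃ (S : Finset (Fin d)) (z : ∀ i : S, Ω i) (hz : z ∈ X.projFaces S),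
          (S.card : ℝ) ≤ C * K ∧
            (2 : ℝ) ^ (-(C * K)) ≤ (X.link S z hz).expect (toReal01 f) := by
  -- The `40` leaves `2^(-38d)` after the loss of `d²` in `almostCommute`. The `156` is `26 * 6`:
  -- the density is `2^(-26r)` and `r ≤ 6K`.
  refine ⟨40, 156, by norm_num, by norm_num, ?_⟩
  intro d Ω _ X γ K f hX hγ hK ⟨x₀, hx₀, hfx₀⟩ hI
  set F : X.faces → ℝ := fun x => toReal01 f x.1 with hF
  have hone : (2 : ℝ) ^ (-(156 * K)) ≤ 1 :=
    Real.rpow_le_one_of_one_le_of_nonpos one_le_two (by linarith)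
  suffices hS : ∃ (S : Finset (Fin d)) (x : X.faces), (S.card : ℝ) ≤ 156 * K ∧
      (2 : ℝ) ^ (-(156 * K)) ≤ X.cexp S F x by
    obtain ⟨S, x, h1, h2⟩ := hS
    exact ⟨S, S.restrict x.1, restrict_mem_projFaces S x, h1,
      by rwa [link_expect x (restrict_mem_projFaces S x)]⟩
  -- When `d` is within the budget, fix all coordinates at a point where `f` is nonzero.
  have htriv : (d : ℝ) ≤ 156 * K → ∃ (S : Finset (Fin d)) (x : X.faces),
      (S.card : ℝ) ≤ 156 * K ∧ (2 : ℝ) ^ (-(156 * K)) ≤ X.cexp S F x := by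
    intro hd
    refine ⟨Finset.univ, ⟨x₀, hx₀⟩, by simpa using hd, ?_⟩
    rw [cexp_univ]
    exact hone.trans_eq (toReal01_eq_one hfx₀).symm
  rcases Nat.eq_zero_or_pos d with rfl | hd
  · exact htriv (by simpa using hK)
  have hff : F * F = F := funext fun x => toReal01_mul_self f x.1
  have hγ0 : (2 : ℝ) ^ (-(40 * (d : ℝ))) = (1 / 2) ^ (40 * d) := by
    rw [Real.rpow_neg zero_le_two, one_div, inv_pow, ← Real.rpow_natCast]
    push_cast
    rfl
  -- Enlarging `γ` to `2^(-40d)` also makes it nonnegative, which is not assumed.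
  have hAC := (hX.mono (hγ.trans_eq hγ0)).almostCommute (by positivity)
  set η : ℝ := (d : ℝ) ^ 2 * (1 / 2) ^ (40 * d) with hη
  have hη0 : 0 ≤ η := by positivity
  have hηd : η ≤ (1 / 2) ^ (38 * d) := by
    have h1 : (d : ℝ) ^ 2 ≤ (2 ^ d) ^ 2 := by
      have : (d : ℝ) ≤ 2 ^ d := by exact_mod_cast Nat.lt_two_pow_self.le
      gcongr
    calc η ≤ (2 ^ d) ^ 2 * (1 / 2) ^ (2 * d + 38 * d) := by
          rw [hη, ← add_mul]
          gcongr
      _ = (1 / 2) ^ (38 * d) := by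
          rw [pow_add, ← mul_assoc, ← pow_mul, mul_comm d 2, ← mul_pow]
          norm_num
  set μ := X.avg F with hμ
  have hμF : X.nrm F ^ 2 = μ := by rw [nrm_sq, hff]
  have hμ0 : 0 < μ := by
    have h1 : F ⟨x₀, hx₀⟩ = 1 := toReal01_eq_one hfx₀
    refine Finset.sum_pos' (fun x _ => mul_nonneg (wt_pos x).le (Nat.cast_nonneg _))
      ⟨⟨x₀, hx₀⟩, Finset.mem_univ _, ?_⟩
    rw [h1, mul_one]
    exact wt_pos _
  have hF0 : 0 < X.nrm F :=
    lt_of_le_of_ne (nrm_nonneg F) fun h => by rw [← h] at hμF; norm_num at hμF; linarith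
  set h : X.faces → ℝ := F - fun _ => μ with hh
  have hvar : X.nrm h ^ 2 = μ - μ ^ 2 := by
    have h1 : h * h = F - (2 * μ) • F + fun _ => μ ^ 2 := by
      ext x
      have h2 : F x * F x = F x := congrFun hff x
      simp only [hh, Pi.mul_apply, Pi.sub_apply, Pi.add_apply, Pi.smul_apply, smul_eq_mul]
      linear_combination h2
    rw [nrm_sq, h1, map_add, map_sub, map_smul, avg_const, ← hμ, smul_eq_mul]
    ring
  rw [totalInfluence_eq_infl, variance_eq_nrm_sq] at hI
  change X.infl F ≤ K * X.nrm h ^ 2 at hI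
  -- Zero variance forces `μ = 1`, as `μ > 0`, and the empty set works.
  rcases (sq_nonneg (X.nrm h)).eq_or_lt with h0 | h0
  · have h1 : μ = 1 := by
      have h2 : μ * (1 - μ) = 0 := by linarith
      rcases mul_eq_zero.1 h2 with h3 | h3 <;> linarith
    refine ⟨∅, ⟨x₀, hx₀⟩, by simpa using hK, ?_⟩
    rw [cexp_empty]
    exact hone.trans_eq h1.symm
  -- The Poincaré inequality bounds `K` from below, so that `r ≥ 1` and rounding is affordable: `4K
  -- + 1 ≤ 6K`.
  have hK2 : 1 / 2 ≤ K := by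
    have h1 := hAC.nrm_sq_le_infl hη0 h (by rw [hh, map_sub, avg_const, sub_self])
    rw [hh, infl_sub_const, ← hh] at h1
    have h2 : 32 ^ d * η ≤ 1 / 32 := by
      calc (32 : ℝ) ^ d * η ≤ 32 ^ d * (1 / 2) ^ (38 * d) := by gcongr
        _ = (1 / 2) ^ (33 * d) := by
            rw [pow_mul, pow_mul, ← mul_pow]; norm_num
        _ ≤ (1 / 2) ^ 5 := pow_le_pow_of_le_one (by norm_num) (by norm_num) (by omega)
        _ = _ := by norm_num
    have h3 : (15 / 16) * X.nrm h ^ 2 ≤ K * X.nrm h ^ 2 := by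
      have := mul_le_mul_of_nonneg_right h2 h0.le
      linarith
    have := le_of_mul_le_mul_right h3 h0
    linarith
  set r := ⌈4 * K⌉₊ with hr
  have hr1 : 4 * K ≤ r := Nat.le_ceil _
  have hr2 : (r : ℝ) ≤ 6 * K := by
    have := Nat.ceil_lt_add_one (show 0 ≤ 4 * K by linarith)
    linarith
  rcases lt_or_ge d (2 * r) with hdr | hdr
  · refine htriv ?_
    have : (d : ℝ) ≤ 2 * r := by exact_mod_cast hdr.le
    linarith
  have hI' : X.infl F ≤ K * X.nrm F ^ 2 :=
    hI.trans (mul_le_mul_of_nonneg_left (by rw [hvar, hμF]; linarith [sq_nonneg μ]) hK)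
  obtain ⟨V, hV, x, hx⟩ := hAC.exists_lt_cexp hη0 hηd hd hff hF0 hI'
    (Nat.one_le_iff_ne_zero.2 fun h => by rw [h] at hr1; norm_num at hr1; linarith) hdr hr1
  refine ⟨V, x, ?_, le_trans ?_ hx.le⟩
  · have : (V.card : ℝ) ≤ 2 * r := by exact_mod_cast hV
    linarith
  · rw [one_div, inv_pow, ← Real.rpow_natCast, ← Real.rpow_neg zero_le_two]
    refine Real.rpow_le_rpow_of_exponent_le one_le_two ?_
    push_cast
    linarith
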